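/- Let $\mathbf{Vect}$ be the category of finite dimensional real vector spaces, with the usual topology on each $\hom(E,F)$. A structure category $\mathbf V$ is a (not necessarily full or closed) subcategory of $\mathbf{Vect}$; its closure $\bar{\mathbf V}$ has the same objects, and $\hom_{\bar{\mathbf V}}(E,F)$ is the closure of $\hom_{\mathbf V}(E,F)$ in $\hom(E,F)$. A functor $\psi\colon\mathbf V\to\mathbf W$ between structure categories is continuous if it is continuous on each morphism space, and regular if it is the restriction of a continuous functor $\bar{\mathbf V}\to\bar{\mathbf W}$. A $\mathbf V$-family is a map $p\colon X\to\bar X$ of spaces with, for each $b\in\bar X$, a homeomorphism $\Phi_b\colon p^{-1}(b)\to X_b$ onto an object $X_b$ of $\mathbf V$. A $\mathbf V$-map is a commuting pair of maps of total and base spaces that is given on each fiber, in the charts, by a morphism of $\mathbf V$; families and $\mathbf V$-maps form the category $\mathbf V\text{-}\mathbf{Top}$. A $\mathbf V$-vector bundle is a family that is locally $\mathbf V$-isomorphic to a product family. A stratified space is a space $\bar X$ that is the colimit of subspaces $\bar X_0\subset\bar X_1\subset\cdots$, where $\bar X_0$ is a CW-space (a space homeomorphic to a CW-complex) and, for $i\ge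 1$, $\bar X_i=\bar M_i\cup_{\bar h_i}\bar X_{i-1}$ for a given CW-pair $(\bar M_i,\bar A_i)$ and a given map $\bar h_i\colon\bar A_i\to\bar X_{i-1}$. A $\mathbf V$-stratified bundle over $\bar X$ is a $\mathbf V$-family $X\to\bar X$ with $\mathbf V$-vector bundles $M_i\to\bar M_i$ and $\mathbf V$-maps $h_i\colon A_i=M_i|\bar A_i\to X_{i-1}$ over $\bar h_i$, where $X_i=X|\bar X_i$, such that $X_0$ is a $\mathbf V$-vector bundle, $X_i$ is the push-out in $\mathbf V\text{-}\mathbf{Top}$ of $M_i\leftarrow A_i\to X_{i-1}$ for $i\geq 1$, and $X$ is the colimit of the $X_i$. Let $\mathbf V\text{-}\mathbf{Stra}$ be the category of these objects, whose morphisms $X\to X'$ are the stratum-preserving $\mathbf V$-stratified maps: a filtration preserving $\mathbf V$-map $f$ with $\bar f(\bar X_i\smallsetminus\bar X_{i-1})\subset\bar X'_i\smallsetminus\bar X'_{i-1}$, together with $\mathbf V$-maps $g_i\colon M_i\to M_i'$ that send $A_i$ to $A_i'$ and are compatible with $f$, with the attaching maps and with the maps $M_i\to X_i$, $M'_i\to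 X'_i$. **Theorem.** Let $\psi\colon\mathbf V\to\mathbf W$ be a regular continuous functor between subcategories of $\mathbf{Vect}$. There is an induced functor $\psi\colon\mathbf V\text{-}\mathbf{Stra}\to\mathbf W\text{-}\mathbf{Stra}$ which sends a $\mathbf V$-stratified bundle $X$ over the stratified space $\bar X$ to a $\mathbf W$-stratified bundle $\psi X$ over the same stratified space $\bar X$ with fibers $(\psi X)_b=\psi(X_b)$, $b\in\bar X$, and a morphism $(f,\{g_i\})$ to a morphism $(\psi f,\{\psi g_i\})$ over the same maps of base spaces, which is given on the fibers by applying $\psi$. Moreover $\psi X$ is built stratum by stratum: its restriction to $\bar X_0$ and its attached bundles are the $\mathbf W$-vector bundles $\psi(X_0)$ and $\psi(M_i)$, and $(\psi X)_i$ is the push-out of $\psi(M_i)\leftarrow\psi(A_i)\to(\psi X)_{i-1}$ along $\psi(h_i)$. Here, for a $\mathbf V$-vector bundle $M$, $\psi(M)$ is the $\mathbf W$-vector bundle with fibers $\psi(M_b)$ such that for every $\mathbf V$-map $Z\times E\to M$ from a product family, applying $\psi$ on fibers gives a (continuous) $\mathbf W$-map $Z\times\psi E\to\psi(M)$. -/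

import Mathlib

open CategoryTheory Topology

universe u

noncomputable section

namespace StratVect

/-! ### Structure categories: subcategories of finite dimensional real vector spaces -/

/-- The standard topology of a finite dimensional real vector space. -/
instance vecTopology (E : FGModuleCat.{u} ℝ) : TopologicalSpace E := moduleTopology ℝ E

instance vecIsModuleTopology (E : FGModuleCat.{u} ℝ) : IsModuleTopology ℝ E := ⟨rfl⟩

/-- The standard topology of the finite dimensional vector space `hom(E, F)`. -/
instance linTopology (E F : FGModuleCat.{u} ℝ) : TopologicalSpace (E →ₗ[ℝ] F) :=
  moduleTopology ℝ (E →ₗ[ℝ] F)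

instance linIsModuleTopology (E F : FGModuleCat.{u} ℝ) : IsModuleTopology ℝ (E →ₗ[ℝ] F) := ⟨rfl⟩

theorem continuous_lin_comp (E F G : FGModuleCat.{u} ℝ) :
    Continuous fun p : (F →ₗ[ℝ] G) × (E →ₗ[ℝ] F) => p.1.comp p.2 :=
  IsModuleTopology.continuous_bilinear_of_finite_left (LinearMap.llcomp ℝ E F G)

/-- A (not necessarily full) subcategory of the category of finite dimensional real vector spaces:
a class of objects and, for objects `E`, `F`, a set of linear maps `E → F`. -/
structure StructureCategory where
  obj : Set (FGModuleCat.{u} ℝ)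
  hom : ∀ E F : FGModuleCat.{u} ℝ, Set (E →ₗ[ℝ] F)
  id_mem : ∀ E ∈ obj, LinearMap.id ∈ hom E E
  comp_mem : ∀ E ∈ obj, ∀ F ∈ obj, ∀ G ∈ obj, ∀ f ∈ hom E F, ∀ g ∈ hom F G, g.comp f ∈ hom E G

namespace StructureCategory

/-- The type of objects of a structure category. -/
structure Obj (V : StructureCategory.{u}) where
  space : FGModuleCat.{u} ℝ
  mem : space ∈ V.obj

instance (V : StructureCategory.{u}) : Category V.Obj where
  Hom E F := V.hom E.space F.space
  id E := ⟨LinearMap.id, V.id_mem E.space E.mem⟩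
  comp {E F G} f g :=
    ⟨g.1.comp f.1, V.comp_mem E.space E.mem F.space F.mem G.space G.mem f.1 f.2 g.1 g.2⟩

/-- The linear map underlying a morphism of a structure category. -/
def lin {V : StructureCategory.{u}} {E F : V.Obj} (f : E ⟶ F) : E.space →ₗ[ℝ] F.space :=
  Subtype.val (p := fun g => g ∈ V.hom E.space F.space) f

theorem lin_injective {V : StructureCategory.{u}} {E F : V.Obj} {f g : E ⟶ F}
    (h : lin f = lin g) : f = g :=
  Subtype.ext h

/-- The sets of morphisms carry the subspace topology. -/
instance (V : StructureCategory.{u}) (E F : V.Obj) : TopologicalSpace (E ⟶ F) :=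
  TopologicalSpace.induced lin inferInstance

/-- The closure of a subcategory: the same objects, and the closures of the sets of morphisms. -/
def closure (V : StructureCategory.{u}) : StructureCategory.{u} where
  obj := V.obj
  hom E F := _root_.closure (V.hom E F)
  id_mem E hE := subset_closure (V.id_mem E hE)
  comp_mem E hE F hF G hG _ hf _ hg :=
    map_mem_closure₂ (continuous_lin_comp E F G) hg hf
      fun g' hg' f' hf' => V.comp_mem E hE F hF G hG f' hf' g' hg'

/-- The inclusion of a subcategory in its closure. -/
def toClosure (V : StructureCategory.{u}) : V.Obj ⥤ V.closure.Obj where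
  obj E := ⟨E.space, E.mem⟩
  map f := ⟨f.1, subset_closure f.2⟩

end StructureCategory

/-- A functor between structure categories is continuous if it is continuous on morphism sets. -/
def IsContinuousFunctor {V W : StructureCategory.{u}} (ψ : V.Obj ⥤ W.Obj) : Prop :=
  ∀ E F : V.Obj, Continuous fun f : E ⟶ F => ψ.map f

/-- A functor is regular if it is the restriction of a continuous functor between the closures. -/
def IsRegularFunctor {V W : StructureCategory.{u}} (ψ : V.Obj ⥤ W.Obj) : Prop :=
  ∃ ψ' : V.closure.Obj ⥤ W.closure.Obj,
    IsContinuousFunctor ψ' ∧ V.toClosure ⋙ ψ' = ψ ⋙ W.toClosure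

/-! ### Families of vector spaces -/

/-- A family of vector spaces in `V` over the base space `B`. The chart at `b`, a homeomorphism
of `p ⁻¹ {b}` with an object `fiber b` of `V`, is recorded through its inverse, regarded as an
embedding `chartInv b` of `fiber b` in the total space with image `p ⁻¹ {b}`. -/
structure Family (V : StructureCategory.{u}) (B : Type u) [TopologicalSpace B] where
  total : Type u
  [top : TopologicalSpace total]
  p : C(total, B)
  fiber : B → V.Obj
  chartInv : ∀ b, (fiber b).space → total
  isEmbedding : ∀ b, IsEmbedding (chartInv b)
  range_eq : ∀ b, Set.range (chartInv b) = p ⁻¹' {b}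

attribute [instance] Family.top

/-- A `V`-map from `X` to `Y` over a map `φ` of base spaces: a continuous map of total spaces that
in the charts is given, over each `b`, by a morphism `hom b : X_b ⟶ Y_{φ b}` of `V`. That the
projections commute with `total` and `φ` is a consequence, see `FamilyMap.p_total`. -/
structure FamilyMap {V : StructureCategory.{u}} {B B' : Type u} [TopologicalSpace B]
    [TopologicalSpace B'] (X : Family V B) (Y : Family V B') (φ : C(B, B')) where
  total : C(X.total, Y.total)
  hom : ∀ b, X.fiber b ⟶ Y.fiber (φ b)
  total_chartInv : ∀ b (v : (X.fiber b).space),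
    total (X.chartInv b v) = Y.chartInv (φ b) (StructureCategory.lin (hom b) v)

section Families

variable {V : StructureCategory.{u}} {B B' B'' : Type u} [TopologicalSpace B]
  [TopologicalSpace B'] [TopologicalSpace B'']

theorem Family.p_chartInv (X : Family V B) (b : B) (v : (X.fiber b).space) :
    X.p (X.chartInv b v) = b := by
  have h : X.chartInv b v ∈ X.p ⁻¹' {b} := X.range_eq b ▸ Set.mem_range_self v
  exact h

theorem Family.exists_chartInv (X : Family V B) (x : X.total) : ∃ v, X.chartInv (X.p x) v = x := by
  have h : x ∈ X.p ⁻¹' {X.p x} := rfl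
  rwa [← X.range_eq] at h

theorem FamilyMap.p_total {X : Family V B} {Y : Family V B'} {φ : C(B, B')}
    (f : FamilyMap X Y φ) (x : X.total) : Y.p (f.total x) = φ (X.p x) := by
  obtain ⟨v, hv⟩ := X.exists_chartInv x
  conv_lhs => rw [← hv, f.total_chartInv]
  exact Y.p_chartInv _ _

theorem FamilyMap.ext_total {X : Family V B} {Y : Family V B'} {φ : C(B, B')}
    {f g : FamilyMap X Y φ} (h : f.total = g.total) : f = g := by
  have h' : f.hom = g.hom := by
    funext b
    apply StructureCategory.lin_injective
    ext v
    apply (Y.isEmbedding (φ b)).injective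
    rw [← f.total_chartInv, ← g.total_chartInv, h]
  cases f; cases g; cases h; cases h'; rfl

/-- The identity of a family. -/
def FamilyMap.id (X : Family V B) : FamilyMap X X (ContinuousMap.id B) where
  total := ContinuousMap.id _
  hom b := 𝟙 (X.fiber b)
  total_chartInv _ _ := rfl

/-- The composition of `V`-maps. -/
def FamilyMap.comp {X : Family V B} {Y : Family V B'} {Z : Family V B''} {φ : C(B, B')}
    {χ : C(B', B'')} (g : FamilyMap Y Z χ) (f : FamilyMap X Y φ) : FamilyMap X Z (χ.comp φ) where
  total := g.total.comp f.total
  hom b := f.hom b ≫ g.hom (φ b)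
  total_chartInv b v := by
    rw [ContinuousMap.comp_apply, f.total_chartInv, g.total_chartInv]; rfl

/-- The product family `B × E → B`. -/
def Family.product (B : Type u) [TopologicalSpace B] (E : V.Obj) : Family V B where
  total := B × E.space
  p := ⟨Prod.fst, continuous_fst⟩
  fiber _ := E
  chartInv b v := (b, v)
  isEmbedding b := isEmbedding_prodMkRight b
  range_eq b := by
    ext x
    constructor
    · rintro ⟨v, rfl⟩; rfl
    · intro h; exact ⟨x.2, Prod.ext (Eq.symm h) rfl⟩

theorem Family.chartInv_mem (X : Family V B) (S : Set B) (b : S) (v : (X.fiber b.1).space) :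
    X.p (X.chartInv b.1 v) ∈ S :=
  (X.p_chartInv b.1 v).symm ▸ b.2

/-- The restriction `X|S` of a family to a subspace of the base. -/
def Family.restrict (X : Family V B) (S : Set B) : Family V S where
  total := {x : X.total // X.p x ∈ S}
  p := ⟨fun x => ⟨X.p x.1, x.2⟩,
    (X.p.continuous.comp continuous_subtype_val).subtype_mk fun x => x.2⟩
  fiber b := X.fiber b.1
  chartInv b v := ⟨X.chartInv b.1 v, X.chartInv_mem S b v⟩
  isEmbedding b := (X.isEmbedding b.1).codRestrict {x | X.p x ∈ S} (X.chartInv_mem S b)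
  range_eq b := by
    ext x
    constructor
    · rintro ⟨v, rfl⟩; exact Subtype.ext (X.p_chartInv b.1 v)
    · intro h
      have h' : x.1 ∈ X.p ⁻¹' {b.1} := congrArg Subtype.val h
      rw [← X.range_eq] at h'
      obtain ⟨v, hv⟩ := h'
      exact ⟨v, Subtype.ext hv⟩

/-- The inclusion `X|S → X`. -/
def Family.restrictVal (X : Family V B) (S : Set B) :
    FamilyMap (X.restrict S) X ⟨Subtype.val, continuous_subtype_val⟩ where
  total := ⟨Subtype.val, continuous_subtype_val⟩
  hom b := 𝟙 (X.fiber b.1)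
  total_chartInv _ _ := rfl

theorem Family.continuous_inclusion (X : Family V B) {S T : Set B} (h : S ⊆ T) :
    Continuous fun x : (X.restrict S).total => (⟨x.1, h x.2⟩ : (X.restrict T).total) :=
  Continuous.subtype_mk (p := fun x => X.p x ∈ T) continuous_subtype_val _

/-- The inclusion `X|S → X|T` for `S ⊆ T`. -/
def Family.restrictInclusion (X : Family V B) {S T : Set B} (h : S ⊆ T) :
    FamilyMap (X.restrict S) (X.restrict T) ⟨Set.inclusion h, _root_.continuous_inclusion h⟩ where
  total := ⟨_, X.continuous_inclusion h⟩
  hom b := 𝟙 (X.fiber b.1)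
  total_chartInv _ _ := rfl

end Families

/-- The category `V`-`Top` of all families of vector spaces in `V`, over arbitrary bases. -/
structure VTop (V : StructureCategory.{u}) where
  base : Type u
  [top : TopologicalSpace base]
  fam : Family V base

attribute [instance] VTop.top

/-- The morphisms of `V`-`Top`: pairs consisting of a map of bases and a `V`-map over it. -/
structure VTop.Hom {V : StructureCategory.{u}} (X Y : VTop V) where
  base : C(X.base, Y.base)
  fam : FamilyMap X.fam Y.fam base

instance (V : StructureCategory.{u}) : Category (VTop V) where
  Hom X Y := VTop.Hom X Y
  id X := ⟨ContinuousMap.id _, FamilyMap.id X.fam⟩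
  comp f g := ⟨g.base.comp f.base, g.fam.comp f.fam⟩

section Families

variable {V : StructureCategory.{u}} {B B' : Type u} [TopologicalSpace B] [TopologicalSpace B']

/-- A family as an object of `V`-`Top`. -/
def Family.toVTop (X : Family V B) : VTop V := ⟨B, X⟩

/-- A `V`-map as a morphism of `V`-`Top`. -/
def FamilyMap.toHom {X : Family V B} {Y : Family V B'} {φ : C(B, B')} (f : FamilyMap X Y φ) :
    X.toVTop ⟶ Y.toVTop := VTop.Hom.mk φ f

/-- A family is trivial if it is `V`-isomorphic to a product family. -/
def Family.IsTrivial (X : Family V B) : Prop :=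
  ∃ E : V.Obj, Nonempty (X.toVTop ≅ (Family.product B E).toVTop)

/-- A `V`-vector bundle is a locally trivial family. -/
def Family.IsBundle (X : Family V B) : Prop :=
  ∀ b : B, ∃ U ∈ 𝓝 b, (X.restrict U).IsTrivial

end Families

/-! ### Stratified spaces -/

/-- A CW-space: a (Hausdorff) space that admits the structure of a CW-complex. -/
def IsCWSpace (M : Type u) [TopologicalSpace M] : Prop :=
  T2Space M ∧ Nonempty (CWComplex (Set.univ : Set M))

/-- `(M, A)` is a CW-pair: `M` has a structure of CW-complex of which `A` is a subcomplex. -/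
def IsCWPair (M : Type u) [TopologicalSpace M] (A : Set M) : Prop :=
  T2Space M ∧ ∃ _ : CWComplex (Set.univ : Set M),
    ∃ S : CWComplex.Subcomplex (Set.univ : Set M), S.carrier = A

/-- A stratified space. The subspace `filt n` is the `n`-th stage of the filtration, and
`filt (n + 1)` arises from `filt n` by attaching the CW-pair `(M n, A n)` through `attach n`;
the space is the colimit of the stages. -/
structure StratifiedSpace where
  carrier : Type u
  [top : TopologicalSpace carrier]
  filt : ℕ → Set carrier
  filt_le : ∀ n, filt n ⊆ filt (n + 1)
  iUnion_filt : ⋃ n, filt n = Set.univ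
  coherent : IsCoherentWith (Set.range filt)
  isCWSpace_zero : IsCWSpace (filt 0)
  M : ℕ → Type u
  [topM : ∀ n, TopologicalSpace (M n)]
  A : ∀ n, Set (M n)
  isCWPair : ∀ n, IsCWPair (M n) (A n)
  attach : ∀ n, C(A n, filt n)
  char : ∀ n, C(M n, filt (n + 1))
  isPushout : ∀ n, IsPushout
    (TopCat.ofHom (⟨Subtype.val, continuous_subtype_val⟩ : C(A n, M n)))
    (TopCat.ofHom (attach n))
    (TopCat.ofHom (char n))
    (TopCat.ofHom (⟨Set.inclusion (filt_le n), continuous_inclusion _⟩ :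
      C(filt n, filt (n + 1))))

attribute [instance] StratifiedSpace.top StratifiedSpace.topM

/-- A stratum-preserving map of stratified spaces: a filtration preserving map, together with maps
`g n` of the attached pairs compatible with attaching and characteristic maps, that sends
each stratum into the stratum of the same index. -/
structure StratifiedSpace.Hom (B B' : StratifiedSpace.{u}) where
  map : C(B.carrier, B'.carrier)
  map_filt : ∀ n, Set.MapsTo map (B.filt n) (B'.filt n)
  g : ∀ n, C(B.M n, B'.M n)
  g_A : ∀ n, Set.MapsTo (g n) (B.A n) (B'.A n)
  attach_comm : ∀ n (a : B.A n),
    map (B.attach n a).1 = (B'.attach n ⟨g n a.1, g_A n a.2⟩).1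
  char_comm : ∀ n (m : B.M n), map (B.char n m).1 = (B'.char n (g n m)).1
  map_stratum : ∀ n, Set.MapsTo map (B.filt (n + 1) \ B.filt n) (B'.filt (n + 1) \ B'.filt n)

/-- The category of stratified spaces and stratum-preserving maps. -/
instance : Category StratifiedSpace.{u} where
  Hom B B' := StratifiedSpace.Hom B B'
  id B :=
    { map := ContinuousMap.id _
      map_filt := fun _ _ h => h
      g := fun _ => ContinuousMap.id _
      g_A := fun _ _ h => h
      attach_comm := fun _ _ => rfl
      char_comm := fun _ _ => rfl
      map_stratum := fun _ _ h => h }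
  comp {_ _ _} φ χ :=
    { map := χ.map.comp φ.map
      map_filt := fun n _ h => χ.map_filt n (φ.map_filt n h)
      g := fun n => (χ.g n).comp (φ.g n)
      g_A := fun n _ h => χ.g_A n (φ.g_A n h)
      attach_comm := fun n a => by
        rw [ContinuousMap.comp_apply, φ.attach_comm, χ.attach_comm]; rfl
      char_comm := fun n m => by
        rw [ContinuousMap.comp_apply, φ.char_comm, χ.char_comm]; rfl
      map_stratum := fun n _ h => χ.map_stratum n (φ.map_stratum n h) }

/-! ### Stratified bundles -/

/-- A `V`-stratified bundle over a stratified space `B`: a `V`-family `X` over `B` with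
`V`-vector bundles `M n` over the attached spaces, such that `X|B_0` is a `V`-vector bundle,
`X|B_{n+1}` is the push-out in `V`-`Top` of `M n ← (M n)|A_n → X|B_n`, and `X` is the colimit of
the `X|B_n`. -/
structure StratifiedBundle (V : StructureCategory.{u}) (B : StratifiedSpace.{u}) where
  fam : Family V B.carrier
  isBundle_zero : (fam.restrict (B.filt 0)).IsBundle
  M : ∀ n, Family V (B.M n)
  isBundle : ∀ n, (M n).IsBundle
  attach : ∀ n, FamilyMap ((M n).restrict (B.A n)) (fam.restrict (B.filt n)) (B.attach n)
  char : ∀ n, FamilyMap (M n) (fam.restrict (B.filt (n + 1))) (B.char n)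
  isPushout : ∀ n, IsPushout
    ((M n).restrictVal (B.A n)).toHom
    (attach n).toHom
    (char n).toHom
    (fam.restrictInclusion (B.filt_le n)).toHom
  coherent : IsCoherentWith (Set.range fun n => fam.p ⁻¹' B.filt n)

/-- A `V`-stratified map over a map `φ` of stratified spaces: a `V`-map `f : X → Y` and `V`-maps
`g n : M n → M' n`, compatible with attaching and characteristic maps. -/
structure StratifiedBundle.MapOver {V : StructureCategory.{u}} {B B' : StratifiedSpace.{u}}
    (X : StratifiedBundle V B) (Y : StratifiedBundle V B') (φ : B ⟶ B') where
  f : FamilyMap X.fam Y.fam φ.map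
  g : ∀ n, FamilyMap (X.M n) (Y.M n) (φ.g n)
  attach_comm : ∀ n (x : ((X.M n).restrict (B.A n)).total)
    (y : ((Y.M n).restrict (B'.A n)).total), y.1 = (g n).total x.1 →
    f.total ((X.attach n).total x).1 = ((Y.attach n).total y).1
  char_comm : ∀ n (x : (X.M n).total),
    f.total ((X.char n).total x).1 = ((Y.char n).total ((g n).total x)).1

namespace StratifiedBundle

variable {V : StructureCategory.{u}} {B B' B'' : StratifiedSpace.{u}}

/-- The identity of a stratified bundle. -/
def MapOver.id (X : StratifiedBundle V B) : MapOver X X (𝟙 B) where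
  f := FamilyMap.id X.fam
  g n := FamilyMap.id (X.M n)
  attach_comm n x y h := by
    have : y = x := Subtype.ext h
    rw [this]; rfl
  char_comm _ _ := rfl

/-- The composition of stratified maps. -/
def MapOver.comp {X : StratifiedBundle V B} {Y : StratifiedBundle V B'}
    {Z : StratifiedBundle V B''} {φ : B ⟶ B'} {χ : B' ⟶ B''}
    (s : MapOver Y Z χ) (r : MapOver X Y φ) : MapOver X Z (φ ≫ χ) where
  f := s.f.comp r.f
  g n := (s.g n).comp (r.g n)
  attach_comm n x z h := by
    have hy : (r.g n).total x.1 ∈ (Y.M n).p ⁻¹' B'.A n := by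
      rw [Set.mem_preimage, FamilyMap.p_total]
      exact φ.g_A n x.2
    have h1 := r.attach_comm n x ⟨_, hy⟩ rfl
    have h2 := s.attach_comm n ⟨_, hy⟩ z h
    exact (congrArg s.f.total h1).trans h2
  char_comm n x :=
    (congrArg s.f.total (r.char_comm n x)).trans (s.char_comm n ((r.g n).total x))

end StratifiedBundle

/-- Objects of the category `V`-`Stra`: stratified spaces with a `V`-stratified bundle. -/
structure VStra (V : StructureCategory.{u}) where
  base : StratifiedSpace.{u}
  bundle : StratifiedBundle V base

/-- Morphisms of `V`-`Stra`: stratum-preserving `V`-stratified maps. -/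
structure VStra.Hom {V : StructureCategory.{u}} (X Y : VStra V) where
  base : X.base ⟶ Y.base
  bundle : StratifiedBundle.MapOver X.bundle Y.bundle base

instance (V : StructureCategory.{u}) : Category (VStra V) where
  Hom X Y := VStra.Hom X Y
  id X := ⟨𝟙 _, StratifiedBundle.MapOver.id X.bundle⟩
  comp f g := ⟨f.base ≫ g.base, g.bundle.comp f.bundle⟩

/-! ### The functor induced by a functor of structure categories -/

/-- A functor from `V`-stratified bundles to `W`-stratified bundles that leaves the
base stratified spaces and the maps between them unchanged. -/
structure FunctorOverBase (V W : StructureCategory.{u}) where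
  obj : ∀ {B : StratifiedSpace.{u}}, StratifiedBundle V B → StratifiedBundle W B
  map : ∀ {B B' : StratifiedSpace.{u}} {X : StratifiedBundle V B} {Y : StratifiedBundle V B'}
    {φ : B ⟶ B'}, X.MapOver Y φ → (obj X).MapOver (obj Y) φ
  map_id : ∀ {B : StratifiedSpace.{u}} (X : StratifiedBundle V B),
    map (StratifiedBundle.MapOver.id X) = StratifiedBundle.MapOver.id (obj X)
  map_comp : ∀ {B B' B'' : StratifiedSpace.{u}} {X : StratifiedBundle V B}
    {Y : StratifiedBundle V B'} {Z : StratifiedBundle V B''} {φ : B ⟶ B'} {χ : B' ⟶ B''}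
    (r : X.MapOver Y φ) (s : Y.MapOver Z χ), map (s.comp r) = (map s).comp (map r)

/-- The underlying functor `V`-`Stra` → `W`-`Stra`. -/
def FunctorOverBase.toFunctor {V W : StructureCategory.{u}} (Ψ : FunctorOverBase V W) :
    VStra V ⥤ VStra W where
  obj X := ⟨X.base, Ψ.obj X.bundle⟩
  map f := VStra.Hom.mk f.base (Ψ.map f.bundle)
  map_id X :=
    congrArg (VStra.Hom.mk (X := ⟨X.base, Ψ.obj X.bundle⟩) (Y := ⟨X.base, Ψ.obj X.bundle⟩)
      (𝟙 X.base)) (Ψ.map_id X.bundle)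
  map_comp {X _ Z} f g :=
    congrArg (VStra.Hom.mk (X := ⟨X.base, Ψ.obj X.bundle⟩) (Y := ⟨Z.base, Ψ.obj Z.bundle⟩)
      (f.base ≫ g.base)) (Ψ.map_comp f.bundle g.bundle)

section Image

variable {V W : StructureCategory.{u}} (ψ : V.Obj ⥤ W.Obj)
  {B B' : Type u} [TopologicalSpace B] [TopologicalSpace B']

/-- The fibers of the `W`-family `Y` are the images `ψ X_b` of the fibers of the `V`-family `X`. -/
def FibersImage (X : Family V B) (Y : Family W B) : Prop :=
  ∀ b, Y.fiber b = ψ.obj (X.fiber b)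

/-- The `W`-map `f'` is given over each point `b` by `ψ` of the morphism that gives `f`. -/
def MapImage {X : Family V B} {X' : Family V B'} {Y : Family W B} {Y' : Family W B'}
    {φ : C(B, B')} (h : FibersImage ψ X Y) (h' : FibersImage ψ X' Y')
    (f : FamilyMap X X' φ) (f' : FamilyMap Y Y' φ) : Prop :=
  ∀ b, f'.hom b = eqToHom (h b) ≫ ψ.map (f.hom b) ≫ eqToHom (h' (φ b)).symm

/-- `ψ` carries `V`-maps from product families `Z × E` to `X`, for instance the inverses of local
trivializations, to (continuous) `W`-maps from `Z × ψ E` to `Y`. If `X` and `Y` are bundles, this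
determines the topology of `Y`: it is the one of the bundle `ψ X`. -/
def ProductMapsImage (X : Family V B) (Y : Family W B) : Prop :=
  ∃ h : FibersImage ψ X Y, ∀ (Z : Type u) [TopologicalSpace Z] (E : V.Obj) (φ : C(Z, B))
    (t : FamilyMap (Family.product Z E) X φ),
    ∃ t' : FamilyMap (Family.product Z (ψ.obj E)) Y φ, MapImage ψ (fun _ => rfl) h t t'

/-- The `W`-stratified bundle `Y` is the stratified bundle `ψ X`: its fibers are the `ψ X_b`, its
restriction to the lowest stage and its attached bundles are the images under `ψ` of those
of `X`, and it is glued from them along the images under `ψ` of the attaching maps of `X`. -/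
structure BundleImage {B : StratifiedSpace.{u}} (X : StratifiedBundle V B)
    (Y : StratifiedBundle W B) : Prop where
  fibers : FibersImage ψ X.fam Y.fam
  fibersM : ∀ n, FibersImage ψ (X.M n) (Y.M n)
  bundle_zero : ProductMapsImage ψ (X.fam.restrict (B.filt 0)) (Y.fam.restrict (B.filt 0))
  bundleM : ∀ n, ProductMapsImage ψ (X.M n) (Y.M n)
  attach : ∀ n, MapImage ψ (fun b => fibersM n b.1) (fun b => fibers b.1) (X.attach n) (Y.attach n)
  char : ∀ n, MapImage ψ (fibersM n) (fun b => fibers b.1) (X.char n) (Y.char n)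

end Image

/-- The functor `Ψ` is induced by `ψ`: it is over the base spaces, it sends each stratified bundle
`X` to `ψ X`, and it is given by `ψ` on the fibers on morphisms. -/
def IsInducedFunctor {V W : StructureCategory.{u}} (ψ : V.Obj ⥤ W.Obj)
    (Ψ : VStra V ⥤ VStra W) : Prop :=
  ∃ Ψ' : FunctorOverBase V W, Ψ = Ψ'.toFunctor ∧
    ∃ h : ∀ {B : StratifiedSpace.{u}} (X : StratifiedBundle V B), BundleImage ψ X (Ψ'.obj X),
      ∀ {B B' : StratifiedSpace.{u}} {X : StratifiedBundle V B} {Y : StratifiedBundle V B'}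
        {φ : B ⟶ B'} (r : X.MapOver Y φ),
        MapImage ψ (h X).fibers (h Y).fibers r.f (Ψ'.map r).f ∧
        ∀ n, MapImage ψ ((h X).fibersM n) ((h Y).fibersM n) (r.g n) ((Ψ'.map r).g n)

end StratVect

end

/-!
The stratified bundle `ψ X` is obtained by applying `ψ` fiber by fiber; the content of the theorem
is that the disjoint union of the spaces `ψ (X_b)` has a topology with all the required properties.

**The topology.** For every family `X` with `T1` base, `ψ X` carries the finest topology such that
`ψ(α i) (w i)` converges to `ψ(α') w'` whenever `w i → w'` in `ψ E` and the morphisms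
`α i : E ⟶ X_{b i}` of `V` converge continuously to `α' : E ⟶ X_{b'}`, that is, when they define a
continuous map to `X` on the product of `E` with a convergent sequence (`Family.Conv`). Since `V`-maps
preserve continuous convergence, `X ↦ ψ X` is functorial by construction (`ImageTotal.map`). The
continuity of `ψ` alone gives that fibers are embedded (`ImageTotal.isClosedEmbedding_mk`). The
construction commutes with restrictions to closed and to open subspaces of the base, and it turns
product families over sequential spaces into product families. Therefore it preserves vector bundles
over CW-complexes (`Family.IsBundle.image`, `sequentialSpace_of_cwComplex`).

**Push-outs.** A push-out of families `M ← M|A → X` over an attaching square of base spaces is the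
same as an attaching square of total spaces in which the maps of fibers are isomorphisms over
`M \ A` and over `X` (`isPushout_of_isAttachment` and, by comparison with an explicitly glued family,
`isAttachment_of_isPushout_family`). So one has to show that a subset `C` of `ψ F`, with
`F = M ∪_A X`, is closed if its preimages in `ψ M` and `ψ X` are closed
(`ImageTotal.isClosed_of_preimage`). Let `α i → α'` converge continuously in `F` with
`ψ(α i) (w i) ∈ C`. If infinitely many `α i` lie over the closed part, `C ∩ ψ X` decides. Otherwise
the `α i` lift to `β i : E ⟶ M_{m i}` with `m i ∉ A`. A sequence in a CW-complex has a convergent or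
a locally finite subsequence (`exists_subseq_of_cwComplex`), and the latter cannot converge in the
attaching space (`IsAttachment.not_tendsto`); so `m i → m'` on a subsequence. For the same reason,
the `β i` are pointwise bounded in a local trivialization near `m'`, so that they subconverge to a
linear map `γ'` in the closure of the morphisms of `V` (`exists_lift_of_tendsto`), with
`α' = c ∘ γ'` for the characteristic map `c`. Here `γ'` need not belong to `V`, as `c` may fail to be
injective over `A`; but regularity says exactly that the `ψ(β i)` converge to the image of `γ'` under
the extension of `ψ` (`IsRegularFunctor.exists_limit`). As the preimage of `C` in `ψ M` is closed,
`ψ(α') w' ∈ C`.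

**Colimits.** `ψ X` is the colimit of its restrictions to the stages of the filtration because a
convergent sequence in the base is infinitely often in one stage
(`StratifiedSpace.exists_frequently_mem_filt`).
-/

noncomputable section

namespace StratVect

open Filter Set StructureCategory

/-! ### Locally finite sequences -/

section LocallyFiniteSequences

variable {T T' : Type*} [TopologicalSpace T] [TopologicalSpace T']

theorem isClosed_image_of_locallyFinite [T1Space T] {x : ℕ → T}
    (hx : LocallyFinite fun i => ({x i} : Set T)) (s : Set ℕ) : IsClosed (x '' s) := by
  have h : LocallyFinite fun i : s => ({x i} : Set T) := hx.comp_injective Subtype.val_injective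
  have := h.isClosed_iUnion fun _ => isClosed_singleton
  convert this using 1
  ext y; simp [eq_comm]

theorem locallyFinite_singleton_iff {x : ℕ → T} :
    LocallyFinite (fun i => ({x i} : Set T)) ↔
      ∀ y, ∃ U ∈ 𝓝 y, ∀ᶠ i in atTop, x i ∉ U := by
  simp only [LocallyFinite, singleton_inter_nonempty, ← Nat.cofinite_eq_atTop,
    eventually_cofinite, not_not]

theorem locallyFinite_of_continuous {f : T → T'} (hf : Continuous f) {x : ℕ → T}
    (hx : LocallyFinite fun i => ({f (x i)} : Set T')) :
    LocallyFinite fun i => ({x i} : Set T) := by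
  rw [locallyFinite_singleton_iff] at hx ⊢
  intro y
  obtain ⟨U, hU, h⟩ := hx (f y)
  exact ⟨f ⁻¹' U, hf.continuousAt hU, h⟩

/-- A sequence that is in each set of a cover only finitely often is locally finite, provided that
closedness can be tested on the sets of the cover. -/
theorem locallyFinite_of_finite_inter [T1Space T] {ι : Type*} {K : ι → Set T}
    (hcover : ∀ x, ∃ k, x ∈ K k)
    (hK : ∀ S : Set T, (∀ k, IsClosed (S ∩ K k)) → IsClosed S) {x : ℕ → T}
    (hx : ∀ k, {i | x i ∈ K k}.Finite) : LocallyFinite fun i => ({x i} : Set T) := by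
  rw [locallyFinite_singleton_iff]
  intro y
  have hcl : IsClosed (range x \ {y}) := by
    refine hK _ fun k => Set.Finite.isClosed (((hx k).image x).subset ?_)
    rintro _ ⟨⟨⟨i, rfl⟩, -⟩, hi⟩
    exact ⟨i, hi, rfl⟩
  refine ⟨(range x \ {y})ᶜ, hcl.isOpen_compl.mem_nhds (by simp), ?_⟩
  obtain ⟨k, hk⟩ := hcover y
  have hfin : {i | x i = y}.Finite := (hx k).subset fun i (hi : x i = y) =>
    show x i ∈ K k from hi.symm ▸ hk
  rw [← Nat.cofinite_eq_atTop, eventually_cofinite]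
  refine hfin.subset fun i hi => ?_
  simp only [mem_ofPred_eq, mem_compl_iff, Set.mem_sdiff, not_not] at hi
  by_contra hne
  exact hi ⟨mem_range_self i, hne⟩

/-- A map from the product of a sequential space and a locally compact first countable space is
continuous if it is sequentially continuous. -/
theorem continuous_of_seq_prod {Z F T : Type*} [TopologicalSpace Z] [TopologicalSpace F]
    [TopologicalSpace T] [SequentialSpace Z] [LocallyCompactSpace F] [FirstCountableTopology F]
    {g : Z × F → T}
    (hg : ∀ (z : ℕ → Z) (z' : Z) (w : ℕ → F) (w' : F), Tendsto z atTop (𝓝 z') →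
      Tendsto w atTop (𝓝 w') → Tendsto (fun i => g (z i, w i)) atTop (𝓝 (g (z', w')))) :
    Continuous g := by
  have h1 : ∀ z, Continuous fun w => g (z, w) := fun z =>
    SeqContinuous.continuous fun w w' hw => hg (fun _ => z) z w w' tendsto_const_nhds hw
  -- as `F` is locally compact, it suffices that the curried map to `C(F, T)` is continuous
  let G : Z → C(F, T) := fun z => ⟨fun w => g (z, w), h1 z⟩
  have hG : Continuous G := by
    refine SeqContinuous.continuous fun z z' hz => ?_
    rw [ContinuousMap.tendsto_nhds_compactOpen]
    intro K hK U hU hKU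
    by_contra hcon
    obtain ⟨σ, hσ, hσ'⟩ := extraction_of_frequently_atTop (not_eventually.1 hcon)
    have : ∀ n, ∃ w ∈ K, g (z (σ n), w) ∉ U := fun n => by
      have := hσ' n
      simp only [MapsTo, not_forall] at this
      obtain ⟨w, hw, h⟩ := this
      exact ⟨w, hw, h⟩
    choose w hwK hwU using this
    obtain ⟨w', hw', τ, hτ, hlim⟩ := hK.tendsto_subseq hwK
    have := hg (fun n => z (σ (τ n))) z' (w ∘ τ) w'
      (hz.comp (hσ.tendsto_atTop.comp hτ.tendsto_atTop)) hlim
    obtain ⟨n, hn⟩ := (this.eventually (hU.mem_nhds (hKU hw'))).exists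
    exact hwU _ hn
  exact ContinuousMap.continuous_uncurry_of_continuous ⟨G, hG⟩

theorem sequentialSpace_of_isOpen [SequentialSpace T] {U : Set T} (hU : IsOpen U) :
    SequentialSpace U := by
  refine ⟨fun S hS => ?_⟩
  have : IsClosed (((↑) '' S : Set T) ∪ Uᶜ) := by
    refine IsSeqClosed.isClosed fun x y hx hxy => ?_
    by_cases hy : y ∈ U
    · left
      have hev := hxy.eventually (hU.mem_nhds hy)
      obtain ⟨N, hN⟩ := eventually_atTop.1 hev
      have hmem : ∀ n, x (n + N) ∈ U := fun n => hN _ (Nat.le_add_left _ _)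
      refine ⟨⟨y, hy⟩, hS (x := fun n => ⟨x (n + N), hmem n⟩) ?_ ?_, rfl⟩
      · intro n
        rcases hx (n + N) with ⟨s, hs, h⟩ | h
        · convert hs using 1; exact Subtype.ext h.symm
        · exact absurd (hmem n) h
      · rw [tendsto_subtype_rng]
        exact hxy.comp (tendsto_add_atTop_nat N)
    · exact Or.inr hy
  convert this.preimage (continuous_subtype_val (p := (· ∈ U))) using 1
  ext y; simp

end LocallyFiniteSequences

/-! ### Sequences in CW-complexes -/

section CW

variable {M : Type u} [TopologicalSpace M] [T2Space M] [CWComplex (univ : Set M)]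

theorem sequentialSpace_of_cwComplex : SequentialSpace M := by
  refine ⟨fun S hS => ?_⟩
  rw [CWComplex.closed (univ : Set M) S (subset_univ _)]
  intro n j
  have hcont := RelCWComplex.continuousOn (C := (univ : Set M)) n j
  have hK : IsCompact (Metric.closedBall (0 : Fin n → ℝ) 1 ∩ (RelCWComplex.map n j) ⁻¹' S) := by
    refine (isCompact_closedBall (0 : Fin n → ℝ) 1).of_isClosed_subset ?_ inter_subset_left
    refine IsSeqClosed.isClosed fun x y hx hxy => ?_
    have hy := Metric.isClosed_closedBall.mem_of_tendsto hxy
      (Eventually.of_forall fun n => (hx n).1)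
    refine ⟨hy, hS (fun k => (hx k).2) ?_⟩
    refine (hcont y hy).tendsto.comp (tendsto_nhdsWithin_iff.2 ⟨hxy, ?_⟩)
    exact Eventually.of_forall fun n => (hx n).1
  have : S ∩ RelCWComplex.closedCell n j = RelCWComplex.map n j ''
      (Metric.closedBall (0 : Fin n → ℝ) 1 ∩ (RelCWComplex.map n j) ⁻¹' S) := by
    rw [image_inter_preimage, inter_comm]; rfl
  rw [this]
  exact (hK.image_of_continuousOn (hcont.mono inter_subset_left)).isClosed

/-- In a CW-complex, a sequence that stays infinitely often in one cell subconverges, and all other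
sequences are locally finite. -/
theorem exists_subseq_of_cwComplex (x : ℕ → M) : ∃ σ : ℕ → ℕ, StrictMono σ ∧
    ((∃ y, Tendsto (x ∘ σ) atTop (𝓝 y)) ∨ LocallyFinite fun i => ({x (σ i)} : Set M)) := by
  by_cases h : ∃ n, ∃ j : RelCWComplex.cell (univ : Set M) n,
      ∃ᶠ i in atTop, x i ∈ RelCWComplex.openCell n j
  · obtain ⟨n, j, h⟩ := h
    obtain ⟨σ, hσ, hσ'⟩ := extraction_of_frequently_atTop h
    choose z hz hzx using hσ'
    have hz' : ∀ i, z i ∈ Metric.closedBall (0 : Fin n → ℝ) 1 := fun i =>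
      Metric.ball_subset_closedBall (hz i)
    obtain ⟨a, ha, τ, hτ, hlim⟩ := (isCompact_closedBall (0 : Fin n → ℝ) 1).tendsto_subseq hz'
    refine ⟨σ ∘ τ, hσ.comp hτ, Or.inl ⟨RelCWComplex.map n j a, ?_⟩⟩
    have hcont := RelCWComplex.continuousOn (C := (univ : Set M)) n j
    have := (hcont a ha).tendsto.comp (tendsto_nhdsWithin_iff.2
      ⟨hlim, Eventually.of_forall fun i => hz' (τ i)⟩)
    refine this.congr fun i => hzx (τ i)
  · refine ⟨id, strictMono_id, Or.inr ?_⟩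
    have hfin : ∀ n (j : RelCWComplex.cell (univ : Set M) n),
        {i | x i ∈ RelCWComplex.openCell n j}.Finite := by
      intro n j
      by_contra hinf
      exact h ⟨n, j, Nat.frequently_atTop_iff_infinite.2 hinf⟩
    refine locallyFinite_of_finite_inter
      (K := fun e : Σ n, RelCWComplex.cell (univ : Set M) n => RelCWComplex.closedCell e.1 e.2)
      ?_ ?_ ?_
    · intro y
      have hy : y ∈ ⋃ (n : ℕ) (j : RelCWComplex.cell (univ : Set M) n),
          RelCWComplex.closedCell n j := by
        rw [CWComplex.union]; trivial
      simp only [mem_iUnion] at hy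
      obtain ⟨n, j, hy⟩ := hy
      exact ⟨⟨n, j⟩, hy⟩
    · intro S hS
      rw [CWComplex.closed (univ : Set M) S (subset_univ _)]
      exact fun n j => hS ⟨n, j⟩
    · rintro ⟨n, j⟩
      obtain ⟨I, hI⟩ := CWComplex.cellFrontier_subset_finite_openCell n j
      rw [← RelCWComplex.cellFrontier_union_openCell_eq_closedCell]
      refine Finite.subset (((finite_Iio n).biUnion fun m _ => (I m).finite_toSet.biUnion
        fun k _ => hfin m k).union (hfin n j)) ?_
      rintro i (hi | hi)
      · left
        have := hI hi
        simp only [mem_iUnion] at this ⊢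
        obtain ⟨m, hm, k, hk, h⟩ := this
        exact ⟨m, hm, k, hk, h⟩
      · exact Or.inr hi

end CW

/-! ### Finite dimensional vector spaces -/

section FiniteDimensional

variable {E F : Type*} [AddCommGroup E] [Module ℝ E] [Module.Finite ℝ E] [TopologicalSpace E]
  [IsModuleTopology ℝ E] [AddCommGroup F] [Module ℝ F] [Module.Finite ℝ F] [TopologicalSpace F]
  [IsModuleTopology ℝ F]

variable (E) in
/-- A finite dimensional vector space with its standard topology is homeomorphic to some `ℝⁿ`. -/
theorem exists_homeomorph_pi : Nonempty (E ≃ₜ (Fin (Module.finrank ℝ E) → ℝ)) := by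
  have := IsModuleTopology.toContinuousAdd ℝ E
  let e := (Module.finBasis ℝ E).equivFun
  exact ⟨{ e.toEquiv with
    continuous_toFun := IsModuleTopology.continuous_of_linearMap e.toLinearMap
    continuous_invFun := IsModuleTopology.continuous_of_linearMap e.symm.toLinearMap }⟩

variable (E) in
theorem firstCountable_of_finite : FirstCountableTopology E :=
  (exists_homeomorph_pi E).some.isInducing.firstCountableTopology

variable (E) in
theorem locallyCompact_of_finite : LocallyCompactSpace E :=
  (exists_homeomorph_pi E).some.isClosedEmbedding.locallyCompactSpace

variable (E) in
theorem t2_of_finite : T2Space E :=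
  (exists_homeomorph_pi E).some.isEmbedding.t2Space

/-- A sequence of vectors is relatively compact or has a locally finite subsequence. -/
theorem exists_isCompact_or_locallyFinite (x : ℕ → E) : (∃ K, IsCompact K ∧ ∀ i, x i ∈ K) ∨
    ∃ σ : ℕ → ℕ, StrictMono σ ∧ LocallyFinite fun i => ({x (σ i)} : Set E) := by
  obtain ⟨e⟩ := exists_homeomorph_pi E
  by_cases h : ∃ C : ℕ, ∀ᶠ i in atTop, ‖e (x i)‖ ≤ C
  · left
    obtain ⟨C, hC⟩ := h
    obtain ⟨N, hN⟩ := eventually_atTop.1 hC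
    refine ⟨e.symm '' Metric.closedBall 0 C ∪ x '' Iio N,
      ((isCompact_closedBall _ _).image e.symm.continuous).union
        ((finite_Iio N).image x).isCompact, fun i => ?_⟩
    rcases lt_or_ge i N with hi | hi
    · exact Or.inr ⟨i, hi, rfl⟩
    · exact Or.inl ⟨e (x i), by simpa using hN i hi, by simp⟩
  · right
    push Not at h
    obtain ⟨σ, hσ, hσ'⟩ := extraction_forall_of_frequently h
    refine ⟨σ, hσ, locallyFinite_of_continuous e.continuous ?_⟩
    rw [locallyFinite_singleton_iff]
    intro y
    refine ⟨Metric.ball y 1, Metric.ball_mem_nhds _ one_pos, ?_⟩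
    obtain ⟨N, hN⟩ := exists_nat_gt (‖y‖ + 1)
    filter_upwards [eventually_ge_atTop N] with i hi hmem
    have h1 := hσ' i
    have h2 : ‖e (x (σ i))‖ < ‖y‖ + 1 := by
      rw [Metric.mem_ball, dist_eq_norm] at hmem
      calc _ = ‖(e (x (σ i)) - y) + y‖ := by simp
        _ ≤ ‖e (x (σ i)) - y‖ + ‖y‖ := norm_add_le _ _
        _ < _ := by linarith
    have h3 : (N : ℝ) ≤ i := by exact_mod_cast hi
    linarith

end FiniteDimensional

section Hom

variable {E F : FGModuleCat.{u} ℝ}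

instance (E : FGModuleCat.{u} ℝ) : FirstCountableTopology E := firstCountable_of_finite E

instance (E : FGModuleCat.{u} ℝ) : LocallyCompactSpace E := locallyCompact_of_finite E

instance (E : FGModuleCat.{u} ℝ) : T2Space E := t2_of_finite E

theorem continuous_linearMap (f : E →ₗ[ℝ] F) : Continuous f :=
  have := IsModuleTopology.toContinuousAdd ℝ F
  IsModuleTopology.continuous_of_linearMap f

theorem continuous_constr : Continuous fun c : Fin (Module.finrank ℝ E) → F =>
    ((Module.finBasis ℝ E).constr ℝ c : E →ₗ[ℝ] F) := by
  have := IsModuleTopology.toContinuousAdd ℝ (E →ₗ[ℝ] F)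
  exact IsModuleTopology.continuous_of_linearMap
    ((Module.finBasis ℝ E).constr (M' := F) ℝ).toLinearMap

/-- On `hom(E, F)`, convergence is pointwise convergence. -/
theorem tendsto_lin_of_pointwise {ι : Type*} {l : Filter ι} {α : ι → E →ₗ[ℝ] F} {β : E →ₗ[ℝ] F}
    (h : ∀ v, Tendsto (fun i => α i v) l (𝓝 (β v))) : Tendsto α l (𝓝 β) := by
  have h1 : ∀ γ : E →ₗ[ℝ] F,
      (Module.finBasis ℝ E).constr ℝ (fun j => γ (Module.finBasis ℝ E j)) = γ :=
    fun γ => (Module.finBasis ℝ E).constr_self ℝ γ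
  have h2 : Tendsto (fun i => fun j => α i (Module.finBasis ℝ E j)) l
      (𝓝 fun j => β (Module.finBasis ℝ E j)) := tendsto_pi_nhds.2 fun j => h _
  have := (continuous_constr (E := E) (F := F)).continuousAt.tendsto.comp h2
  rw [h1] at this
  exact this.congr fun i => h1 (α i)

theorem continuous_lin_apply : Continuous fun q : (E →ₗ[ℝ] F) × E => q.1 q.2 :=
  IsModuleTopology.continuous_bilinear_of_finite_left (LinearMap.id : (E →ₗ[ℝ] F) →ₗ[ℝ] _)

theorem tendsto_lin_apply {ι : Type*} {l : Filter ι} {α : ι → E →ₗ[ℝ] F} {β : E →ₗ[ℝ] F}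
    (h : Tendsto α l (𝓝 β)) {v : ι → E} {v' : E} (hv : Tendsto v l (𝓝 v')) :
    Tendsto (fun i => α i (v i)) l (𝓝 (β v')) :=
  (continuous_lin_apply.tendsto (β, v')).comp (h.prodMk_nhds hv)

/-- A pointwise relatively compact sequence of linear maps has a convergent subsequence. -/
theorem exists_subseq_lin {α : ℕ → E →ₗ[ℝ] F}
    (h : ∀ v, ∃ K, IsCompact K ∧ ∀ i, α i v ∈ K) :
    ∃ (σ : ℕ → ℕ) (β : E →ₗ[ℝ] F), StrictMono σ ∧ Tendsto (α ∘ σ) atTop (𝓝 β) := by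
  choose K hK hKα using h
  obtain ⟨c, -, σ, hσ, hlim⟩ :=
    (isCompact_univ_pi fun j => hK (Module.finBasis ℝ E j)).tendsto_subseq
      (x := fun i j => α i (Module.finBasis ℝ E j)) fun i => fun j _ => hKα _ i
  refine ⟨σ, _, hσ, ((continuous_constr (E := E) (F := F)).continuousAt.tendsto.comp hlim).congr
    fun i => (Module.finBasis ℝ E).constr_self ℝ (α (σ i))⟩

end Hom

/-! ### Continuously convergent sequences in families -/

section Lin

variable {V : StructureCategory.{u}}

@[simp] theorem lin_id (E : V.Obj) : lin (𝟙 E) = LinearMap.id := rfl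

@[simp] theorem lin_comp {E F G : V.Obj} (f : E ⟶ F) (g : F ⟶ G) :
    lin (f ≫ g) = (lin g).comp (lin f) := rfl

theorem continuous_lin {E F : V.Obj} : Continuous (lin : (E ⟶ F) → (E.space →ₗ[ℝ] F.space)) :=
  continuous_induced_dom

theorem isInducing_lin {E F : V.Obj} :
    IsInducing (lin : (E ⟶ F) → (E.space →ₗ[ℝ] F.space)) := ⟨rfl⟩

end Lin

section Conv

variable {V : StructureCategory.{u}} {B B' Z : Type u} [TopologicalSpace B] [TopologicalSpace B']
  [TopologicalSpace Z]

/-- Continuous convergence of the morphisms `α i : E ⟶ X_{b i}` to the morphism `α' : E ⟶ X_{b'}`: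
they form a continuous map to `X` from the product of `E` and a convergent sequence. -/
def Family.Conv (X : Family V B) {E : V.Obj} {b : ℕ → B} (α : ∀ i, E ⟶ X.fiber (b i)) {b' : B}
    (α' : E ⟶ X.fiber b') : Prop :=
  ∀ v : E.space, Tendsto (fun q : ℕ × E.space => X.chartInv (b q.1) (lin (α q.1) q.2))
    (atTop ×ˢ 𝓝 v) (𝓝 (X.chartInv b' (lin α' v)))

namespace Family.Conv

variable {X : Family V B} {E : V.Obj} {b : ℕ → B} {α : ∀ i, E ⟶ X.fiber (b i)} {b' : B}
  {α' : E ⟶ X.fiber b'}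

theorem tendsto (h : X.Conv α α') (v : E.space) :
    Tendsto (fun i => X.chartInv (b i) (lin (α i) v)) atTop (𝓝 (X.chartInv b' (lin α' v))) :=
  (h v).comp (tendsto_id.prodMk tendsto_const_nhds)

theorem tendsto_base (h : X.Conv α α') : Tendsto b atTop (𝓝 b') := by
  have := (X.p.continuous.tendsto _).comp (h.tendsto 0)
  simpa only [Function.comp_def, X.p_chartInv] using this

theorem subseq (h : X.Conv α α') {σ : ℕ → ℕ} (hσ : Tendsto σ atTop atTop) :
    X.Conv (fun i => α (σ i)) α' := fun v =>
  (h v).comp ((hσ.comp tendsto_fst).prodMk tendsto_snd)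

theorem map {Y : Family V B'} {φ : C(B, B')} (f : FamilyMap X Y φ) (h : X.Conv α α') :
    Y.Conv (fun i => α i ≫ f.hom (b i)) (α' ≫ f.hom b') := fun v => by
  have := (f.total.continuous.tendsto _).comp (h v)
  simp only [Function.comp_def, f.total_chartInv] at this
  exact this

end Family.Conv

theorem FamilyMap.conv_of_product {X : Family V B} {E : V.Obj} {φ : C(Z, B)}
    (t : FamilyMap (Family.product Z E) X φ) {z : ℕ → Z} {z' : Z} (hz : Tendsto z atTop (𝓝 z')) :
    X.Conv (fun i => t.hom (z i)) (t.hom z') := fun v => by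
  have h1 : Tendsto (fun q : ℕ × E.space => (z q.1, q.2)) (atTop ×ˢ 𝓝 v) (𝓝 (z', v)) :=
    (hz.comp tendsto_fst).prodMk_nhds tendsto_snd
  have := (t.total.continuous.tendsto (z', v)).comp h1
  refine (this.congr fun q => ?_).trans (le_of_eq ?_)
  · exact t.total_chartInv (z q.1) q.2
  · exact congrArg 𝓝 (t.total_chartInv z' v)

/-- A constant sequence of morphisms converges continuously. -/
theorem Family.conv_const (X : Family V B) {E : V.Obj} {b : B} (α : E ⟶ X.fiber b) :
    X.Conv (fun _ : ℕ => α) α := fun v =>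
  (((X.isEmbedding b).continuous.comp (continuous_linearMap (lin α))).tendsto v).comp tendsto_snd

/-- If a convergent sequence of morphisms stays in one fiber, then it converges in `hom`. -/
theorem Family.Conv.tendsto_hom {X : Family V B} {E : V.Obj} {b : B} {α : ℕ → (E ⟶ X.fiber b)}
    {α' : E ⟶ X.fiber b} (h : X.Conv α α') : Tendsto α atTop (𝓝 α') := by
  rw [isInducing_lin.tendsto_nhds_iff]
  refine tendsto_lin_of_pointwise fun v => ?_
  rw [(X.isEmbedding b).tendsto_nhds_iff]
  exact h.tendsto v

theorem Family.Conv.tendsto_hom_product {E F : V.Obj} {z : ℕ → Z} {z' : Z} {α : ℕ → (E ⟶ F)}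
    {α' : E ⟶ F} (h : (Family.product (V := V) Z F).Conv (b := z) (b' := z') α α') :
    Tendsto α atTop (𝓝 α') := by
  rw [isInducing_lin.tendsto_nhds_iff]
  refine tendsto_lin_of_pointwise fun v => ?_
  exact (continuous_snd.tendsto _).comp (h.tendsto v)

theorem Family.conv_restrict_iff {X : Family V B} {S : Set B} {E : V.Obj} {b : ℕ → S}
    {α : ∀ i, E ⟶ X.fiber (b i).1} {b' : S} {α' : E ⟶ X.fiber b'.1} :
    (X.restrict S).Conv (b := b) (b' := b') α α' ↔
      X.Conv (b := fun i => (b i).1) (b' := b'.1) α α' := by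
  refine forall_congr' fun v => ?_
  exact tendsto_subtype_rng

/-- Morphisms into two fibers of a family that agree as maps to the total space have the same
target and are equal. This is stated as a transport principle, since the two targets are equal
only propositionally. -/
theorem Family.hom_rec (X : Family V B) {E : V.Obj} {P : ∀ b, (E ⟶ X.fiber b) → Prop} {b b' : B}
    {α : E ⟶ X.fiber b} {α' : E ⟶ X.fiber b'}
    (h : ∀ v, X.chartInv b (lin α v) = X.chartInv b' (lin α' v)) (hP : P b α) : P b' α' := by
  have hb : b = b' := by
    have := congrArg X.p (h 0)
    rwa [X.p_chartInv, X.p_chartInv] at this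
  subst hb
  have : α = α' := lin_injective (LinearMap.ext fun v => (X.isEmbedding b).injective (h v))
  exact this ▸ hP

end Conv

/-! ### The image of a family under a functor -/

section Image

variable {V W : StructureCategory.{u}} (ψ : V.Obj ⥤ W.Obj) {B B' B'' Z : Type u}
  [TopologicalSpace B] [TopologicalSpace B'] [TopologicalSpace B''] [TopologicalSpace Z]

/-- The total space of the family `ψ X`: the disjoint union of the spaces `ψ (X_b)`. -/
@[ext]
structure ImageTotal (X : Family V B) : Type u where
  pt : B
  vec : (ψ.obj (X.fiber pt)).space

variable {ψ}

/-- The vector `ψ(α) w`, in the fiber over `b`, where `α : E ⟶ X_b` and `w ∈ ψ E`. -/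
def ImageTotal.push (X : Family V B) {E : V.Obj} {b : B} (α : E ⟶ X.fiber b)
    (w : (ψ.obj E).space) : ImageTotal ψ X :=
  ⟨b, lin (ψ.map α) w⟩

/-- The total space of `ψ X` carries the finest topology for which `ψ(α i) (w i)` converges to
`ψ(α') w'` whenever the morphisms `α i` converge continuously to `α'` and the vectors `w i`
converge to `w'`. -/
instance (X : Family V B) : TopologicalSpace (ImageTotal ψ X) where
  IsOpen U := ∀ (E : V.Obj) (b : ℕ → B) (α : ∀ i, E ⟶ X.fiber (b i)) (b' : B)
    (α' : E ⟶ X.fiber b'), X.Conv α α' → ∀ (w : ℕ → (ψ.obj E).space) (w' : (ψ.obj E).space),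
    Tendsto w atTop (𝓝 w') → ImageTotal.push X α' w' ∈ U →
    ∀ᶠ i in atTop, ImageTotal.push X (α i) (w i) ∈ U
  isOpen_univ _ _ _ _ _ _ _ _ _ _ := Eventually.of_forall fun _ => trivial
  isOpen_inter _ _ h h' E b α b' α' hα w w' hw hU :=
    (h E b α b' α' hα w w' hw hU.1).and (h' E b α b' α' hα w w' hw hU.2)
  isOpen_sUnion _ h E b α b' α' hα w w' hw hU := by
    obtain ⟨U, hUS, hU⟩ := hU
    exact (h U hUS E b α b' α' hα w w' hw hU).mono fun i hi => ⟨U, hUS, hi⟩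

namespace ImageTotal

variable {X : Family V B} {Y : Family V B'}

theorem push_id (X : Family V B) (b : B) (w : (ψ.obj (X.fiber b)).space) :
    push X (𝟙 (X.fiber b)) w = ⟨b, w⟩ := by
  rw [push, ψ.map_id]; rfl

theorem push_comp (X : Family V B) {E F : V.Obj} {b : B} (β : E ⟶ F) (α : F ⟶ X.fiber b)
    (w : (ψ.obj E).space) : push X (β ≫ α) w = push X α (lin (ψ.map β) w) := by
  rw [push, ψ.map_comp]; rfl

theorem push_congr (X : Family V B) {E : V.Obj} {b b' : B} {α : E ⟶ X.fiber b}
    {α' : E ⟶ X.fiber b'} (h : ∀ v, X.chartInv b (lin α v) = X.chartInv b' (lin α' v))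
    (w : (ψ.obj E).space) : push X α w = push X α' w :=
  X.hom_rec (P := fun _ β => push X α w = push X β w) h rfl

theorem tendsto_push {E : V.Obj} {b : ℕ → B} {α : ∀ i, E ⟶ X.fiber (b i)} {b' : B}
    {α' : E ⟶ X.fiber b'} (h : X.Conv α α') {w : ℕ → (ψ.obj E).space} {w' : (ψ.obj E).space}
    (hw : Tendsto w atTop (𝓝 w')) :
    Tendsto (fun i => push X (α i) (w i)) atTop (𝓝 (push X α' w')) := by
  rw [tendsto_nhds]
  exact fun U hU hmem => hU E b α b' α' h w w' hw hmem

theorem continuous_of_push {T : Type*} [TopologicalSpace T] {f : ImageTotal ψ X → T}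
    (hf : ∀ (E : V.Obj) (b : ℕ → B) (α : ∀ i, E ⟶ X.fiber (b i)) (b' : B)
      (α' : E ⟶ X.fiber b'), X.Conv α α' → ∀ (w : ℕ → (ψ.obj E).space) (w' : (ψ.obj E).space),
      Tendsto w atTop (𝓝 w') →
      Tendsto (fun i => f (push X (α i) (w i))) atTop (𝓝 (f (push X α' w')))) :
    Continuous f :=
  continuous_def.2 fun _ hU E b α b' α' h w w' hw hmem =>
    (hf E b α b' α' h w w' hw).eventually (hU.mem_nhds hmem)

theorem isClosed_iff {C : Set (ImageTotal ψ X)} : IsClosed C ↔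
    ∀ (E : V.Obj) (b : ℕ → B) (α : ∀ i, E ⟶ X.fiber (b i)) (b' : B)
      (α' : E ⟶ X.fiber b'), X.Conv α α' → ∀ (w : ℕ → (ψ.obj E).space) (w' : (ψ.obj E).space),
      Tendsto w atTop (𝓝 w') → (∀ i, push X (α i) (w i) ∈ C) → push X α' w' ∈ C := by
  constructor
  · intro hC E b α b' α' h w w' hw hmem
    exact hC.mem_of_tendsto (tendsto_push h hw) (Eventually.of_forall hmem)
  · intro hC
    rw [← isOpen_compl_iff]
    intro E b α b' α' h w w' hw hmem
    by_contra hcon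
    obtain ⟨σ, hσ, hσ'⟩ := extraction_of_frequently_atTop (not_eventually.1 hcon)
    exact hmem (hC E _ _ b' α' (h.subseq hσ.tendsto_atTop) _ w' (hw.comp hσ.tendsto_atTop)
      fun i => not_not.1 (hσ' i))

theorem continuous_pt : Continuous (pt : ImageTotal ψ X → B) :=
  continuous_of_push fun _ _ _ _ _ h _ _ _ => h.tendsto_base

theorem continuous_mk (X : Family V B) (b : B) :
    Continuous fun w : (ψ.obj (X.fiber b)).space => (⟨b, w⟩ : ImageTotal ψ X) := by
  refine SeqContinuous.continuous fun w w' hw => ?_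
  have := tendsto_push (ψ := ψ) (X.conv_const (𝟙 (X.fiber b))) hw
  simpa only [Function.comp_def, push_id] using this

/-- Since a convergent sequence of morphisms into one fiber converges in `hom`, a continuous
functor `ψ` embeds each fiber of `ψ X`. -/
theorem isClosedEmbedding_mk [T1Space B] (hψ : IsContinuousFunctor ψ) (X : Family V B) (b : B) :
    IsClosedEmbedding fun w : (ψ.obj (X.fiber b)).space => (⟨b, w⟩ : ImageTotal ψ X) := by
  refine .of_continuous_injective_isClosedMap (continuous_mk X b)
    (fun w w' h => by cases h; rfl) fun C hC => ?_
  rw [isClosed_iff]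
  intro E c α c' α' h w w' hw hmem
  have hc : ∀ i, c i = b := fun i => by
    obtain ⟨_, _, h⟩ := hmem i
    exact (congrArg pt h).symm
  -- the test sequence stays in the fiber over `b`, and so does its limit, as `{b}` is closed
  obtain rfl : c = fun _ => b := funext hc
  obtain rfl : b = c' := tendsto_const_nhds_iff.1 h.tendsto_base
  refine ⟨_, hC.mem_of_tendsto (tendsto_lin_apply ((continuous_lin.tendsto _).comp
    (((hψ _ _).tendsto _).comp h.tendsto_hom)) hw) (Eventually.of_forall fun i => ?_), rfl⟩
  obtain ⟨u, hu, h⟩ := hmem i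
  cases h
  exact hu

end ImageTotal

/-- The family `ψ X`. -/
def Family.image [T1Space B] (hψ : IsContinuousFunctor ψ) (X : Family V B) : Family W B where
  total := ImageTotal ψ X
  p := ⟨ImageTotal.pt, ImageTotal.continuous_pt⟩
  fiber b := ψ.obj (X.fiber b)
  chartInv b w := ⟨b, w⟩
  isEmbedding b := (ImageTotal.isClosedEmbedding_mk hψ X b).isEmbedding
  range_eq b := by
    ext x
    constructor
    · rintro ⟨w, rfl⟩; rfl
    · rintro rfl; exact ⟨x.vec, rfl⟩

/-- The map of total spaces `ψ X → ψ Y` induced by a `V`-map `X → Y`. -/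
def ImageTotal.map {X : Family V B} {Y : Family V B'} {φ : C(B, B')} (f : FamilyMap X Y φ) :
    C(ImageTotal ψ X, ImageTotal ψ Y) where
  toFun x := push Y (f.hom x.pt) x.vec
  continuous_toFun := continuous_of_push fun E b α b' α' h w w' hw => by
    have := tendsto_push (h.map f) hw
    simp only [push_comp] at this
    exact this

theorem ImageTotal.map_push {X : Family V B} {Y : Family V B'} {φ : C(B, B')}
    (f : FamilyMap X Y φ) {E : V.Obj} {b : B} (α : E ⟶ X.fiber b) (w : (ψ.obj E).space) :
    map f (push X α w) = push Y (α ≫ f.hom b) w :=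
  (push_comp Y α (f.hom b) w).symm

/-- The `W`-map `ψ X → ψ Y` induced by a `V`-map `X → Y`. -/
def FamilyMap.image [T1Space B] [T1Space B'] (hψ : IsContinuousFunctor ψ) {X : Family V B}
    {Y : Family V B'} {φ : C(B, B')} (f : FamilyMap X Y φ) :
    FamilyMap (X.image hψ) (Y.image hψ) φ where
  total := ImageTotal.map f
  hom b := ψ.map (f.hom b)
  total_chartInv _ _ := rfl

/-! ### Images and restrictions -/

namespace ImageTotal

variable (X : Family V B) (S : Set B)

/-- The comparison `(ψ X)|S → ψ (X|S)`. -/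
def ofRestrict (x : {x : ImageTotal ψ X // x.pt ∈ S}) : ImageTotal ψ (X.restrict S) :=
  ⟨⟨x.1.pt, x.2⟩, x.1.vec⟩

variable {S}

theorem continuous_toRestrict : Continuous fun x : ImageTotal ψ (X.restrict S) =>
    (⟨⟨x.pt.1, x.vec⟩, x.pt.2⟩ : {x : ImageTotal ψ X // x.pt ∈ S}) := by
  refine Continuous.subtype_mk ?_ _
  exact (map (ψ := ψ) (X.restrictVal S)).continuous.congr fun x => push_id X x.pt.1 x.vec

theorem continuous_ofRestrict_of_isClosed (hS : IsClosed S) :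
    Continuous (ofRestrict (ψ := ψ) X S) := by
  rw [continuous_iff_isClosed]
  intro C hC
  suffices h : IsClosed ((↑) '' (ofRestrict X S ⁻¹' C) : Set (ImageTotal ψ X)) by
    convert h.preimage continuous_subtype_val using 1
    rw [preimage_image_eq _ Subtype.val_injective]
  rw [isClosed_iff]
  intro E b α b' α' h w w' hw hmem
  have hb : ∀ i, b i ∈ S := fun i => by
    obtain ⟨y, -, hy⟩ := hmem i
    have h1 : y.1.pt = b i := congrArg pt hy
    exact h1 ▸ y.2
  have hb' : b' ∈ S := hS.mem_of_tendsto h.tendsto_base (Eventually.of_forall hb)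
  refine ⟨⟨push X α' w', hb'⟩, ?_, rfl⟩
  have h' : (X.restrict S).Conv (b := fun i => ⟨b i, hb i⟩) (b' := ⟨b', hb'⟩) α α' :=
    Family.conv_restrict_iff.2 h
  refine isClosed_iff.1 hC E _ _ _ _ h' w w' hw fun i => ?_
  obtain ⟨y, hy, hy'⟩ := hmem i
  have : y = ⟨push X (α i) (w i), hb i⟩ := Subtype.ext hy'
  subst this
  exact hy

theorem continuous_ofRestrict_of_isOpen (hS : IsOpen S) :
    Continuous (ofRestrict (ψ := ψ) X S) := by
  rw [continuous_def]
  intro U hU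
  suffices h : IsOpen ((↑) '' (ofRestrict X S ⁻¹' U) : Set (ImageTotal ψ X)) by
    convert h.preimage continuous_subtype_val using 1
    rw [preimage_image_eq _ Subtype.val_injective]
  intro E b α b' α' h w w' hw hmem
  obtain ⟨y, hy, hy'⟩ := hmem
  have h1 : y.1.pt = b' := congrArg pt hy'
  have hb' : b' ∈ S := h1 ▸ y.2
  have : y = ⟨push X α' w', hb'⟩ := Subtype.ext hy'
  subst this
  obtain ⟨N, hN⟩ := eventually_atTop.1 (h.tendsto_base.eventually (hS.mem_nhds hb'))
  have hb : ∀ i, b (i + N) ∈ S := fun i => hN _ (Nat.le_add_left _ _)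
  have h' : (X.restrict S).Conv (b := fun i => ⟨b (i + N), hb i⟩) (b' := ⟨b', hb'⟩)
      (fun i => α (i + N)) α' :=
    Family.conv_restrict_iff.2 (h.subseq (tendsto_add_atTop_nat N))
  have hev := hU E _ _ _ _ h' (fun i => w (i + N)) w' (hw.comp (tendsto_add_atTop_nat N)) hy
  rw [← map_add_atTop_eq_nat N, eventually_map]
  exact hev.mono fun i hi => ⟨⟨push X (α (i + N)) (w (i + N)), hb i⟩, hi, rfl⟩

end ImageTotal

end Image

/-! ### Local trivializations -/

section Families

variable {V : StructureCategory.{u}} {B B' : Type u} [TopologicalSpace B] [TopologicalSpace B']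

/-- Morphisms of `V`-`Top` are determined by the maps of total spaces. -/
theorem VTop.hom_ext {X Y : VTop V} {f g : X ⟶ Y}
    (h : ∀ x, (VTop.Hom.fam f).total x = (VTop.Hom.fam g).total x) : f = g := by
  have hb : VTop.Hom.base f = VTop.Hom.base g := by
    ext b
    have := congrArg Y.fam.p (h (X.fam.chartInv b 0))
    rwa [FamilyMap.p_total, FamilyMap.p_total, X.fam.p_chartInv] at this
  obtain ⟨φ, f⟩ := f
  obtain ⟨χ, g⟩ := g
  obtain rfl : φ = χ := hb
  have : f = g := FamilyMap.ext_total (ContinuousMap.ext h)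
  rw [this]

/-- A continuous map of total spaces that is given on each fiber by some morphism is a `V`-map. -/
def FamilyMap.ofExists {X : Family V B} {Y : Family V B'} {φ : C(B, B')}
    (f : C(X.total, Y.total))
    (h : ∀ b, ∃ g : X.fiber b ⟶ Y.fiber (φ b), ∀ v,
      f (X.chartInv b v) = Y.chartInv (φ b) (lin g v)) : FamilyMap X Y φ where
  total := f
  hom b := (h b).choose
  total_chartInv b := (h b).choose_spec

theorem Family.exists_hom_of_eq (Y : Family V B) {E : V.Obj} {c c' : B} (h : c = c')
    (g : E ⟶ Y.fiber c) :
    ∃ g' : E ⟶ Y.fiber c', ∀ v, Y.chartInv c (lin g v) = Y.chartInv c' (lin g' v) := by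
  subst h; exact ⟨g, fun _ => rfl⟩

/-- A trivialization of the family `X` over an open neighbourhood `U` of `b`, covering the identity
of `U`. -/
structure Family.LocalTriv (X : Family V B) (b : B) where
  U : Set B
  isOpen : IsOpen U
  mem : b ∈ U
  E : V.Obj
  t : FamilyMap (Family.product U E) (X.restrict U) (ContinuousMap.id U)
  s : FamilyMap (X.restrict U) (Family.product U E) (ContinuousMap.id U)
  t_s : ∀ x, t.total (s.total x) = x
  s_t : ∀ q, s.total (t.total q) = q

theorem Family.IsBundle.exists_localTriv {X : Family V B} (hX : X.IsBundle) (b : B) :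
    Nonempty (X.LocalTriv b) := by
  obtain ⟨S, hS, E, ⟨e⟩⟩ := hX b
  have hU : interior S ⊆ S := interior_subset
  let φ : C(S, S) := VTop.Hom.base e.hom
  let χ : C(S, S) := VTop.Hom.base e.inv
  let f : FamilyMap (X.restrict S) (Family.product S E) φ := VTop.Hom.fam e.hom
  let g : FamilyMap (Family.product S E) (X.restrict S) χ := VTop.Hom.fam e.inv
  have hgf : ∀ x, g.total (f.total x) = x := fun x =>
    congrArg (fun k : _ ⟶ _ => (VTop.Hom.fam k).total x) e.hom_inv_id
  have hfg : ∀ x, f.total (g.total x) = x := fun x =>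
    congrArg (fun k : _ ⟶ _ => (VTop.Hom.fam k).total x) e.inv_hom_id
  have hχφ : ∀ x, χ (φ x) = x := fun x =>
    congrArg (fun k : _ ⟶ _ => (VTop.Hom.base k) x) e.hom_inv_id
  have hf1 : ∀ x, (f.total x).1 = φ ((X.restrict S).p x) := fun x => f.p_total x
  let ι : C(interior S, S) := ⟨Set.inclusion hU, _root_.continuous_inclusion hU⟩
  have hpt : ∀ q : interior S × E.space, X.p (g.total (φ (ι q.1), q.2)).1 = q.1.1 := fun q => by
    have := g.p_total (φ (ι q.1), q.2)
    exact congrArg Subtype.val (this.trans (hχφ _))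
  let tt : C((Family.product (interior S) E).total, (X.restrict (interior S)).total) :=
    ⟨fun q => ⟨(g.total (φ (ι q.1), q.2)).1, (hpt q).symm ▸ q.1.2⟩, by
      refine Continuous.subtype_mk (continuous_subtype_val.comp (g.total.continuous.comp ?_)) _
      exact ((φ.continuous.comp ι.continuous).comp continuous_fst).prodMk continuous_snd⟩
  let ss : C((X.restrict (interior S)).total, (Family.product (interior S) E).total) :=
    ⟨fun x => ((X.restrict (interior S)).p x, (f.total ⟨x.1, hU x.2⟩).2), by
      refine ((X.restrict (interior S)).p.continuous).prodMk (continuous_snd.comp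
        (f.total.continuous.comp ?_))
      exact X.continuous_inclusion hU⟩
  refine ⟨⟨interior S, isOpen_interior, mem_interior_iff_mem_nhds.2 hS, E,
    FamilyMap.ofExists tt ?_, FamilyMap.ofExists ss ?_, ?_, ?_⟩⟩
  · intro u
    obtain ⟨k, hk⟩ := (X.restrict S).exists_hom_of_eq (hχφ (ι u)) (g.hom (φ (ι u)))
    refine ⟨k, fun v => Subtype.ext ?_⟩
    have h1 := g.total_chartInv (φ (ι u)) v
    have h2 := h1.trans (hk v)
    exact congrArg (fun x : {x : X.total // X.p x ∈ S} => x.1) h2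
  · intro u
    refine ⟨f.hom (ι u), fun v => ?_⟩
    have h1 := f.total_chartInv (ι u) v
    refine Prod.ext ?_ (congrArg (fun q : S × E.space => q.2) h1)
    exact (X.restrict (interior S)).p_chartInv u v
  · intro x
    refine Subtype.ext ?_
    have h2 : ((φ (ι ((X.restrict (interior S)).p x)), (f.total ⟨x.1, hU x.2⟩).2) :
        S × E.space) = f.total ⟨x.1, hU x.2⟩ := Prod.ext (hf1 ⟨x.1, hU x.2⟩).symm rfl
    have h3 := (congrArg g.total h2).trans (hgf ⟨x.1, hU x.2⟩)
    exact congrArg (fun x : {x : X.total // X.p x ∈ S} => x.1) h3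
  · intro q
    refine Prod.ext (Subtype.ext (hpt q)) ?_
    exact congrArg (fun q : S × E.space => q.2) (hfg (φ (ι q.1), q.2))

namespace Family.LocalTriv

variable {X : Family V B} {b : B} (τ : X.LocalTriv b)

theorem s_hom_comp_t_hom (c : τ.U) : τ.s.hom c ≫ τ.t.hom c = 𝟙 (X.fiber c.1) := by
  refine lin_injective (LinearMap.ext fun v => ((X.restrict τ.U).isEmbedding c).injective ?_)
  have := τ.t_s ((X.restrict τ.U).chartInv c v)
  rw [τ.s.total_chartInv, τ.t.total_chartInv] at this
  exact this

theorem t_hom_comp_s_hom (c : τ.U) : τ.t.hom c ≫ τ.s.hom c = 𝟙 τ.E := by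
  refine lin_injective (LinearMap.ext fun v =>
    ((Family.product τ.U τ.E).isEmbedding c).injective ?_)
  have := τ.s_t ((Family.product τ.U τ.E).chartInv c v)
  rw [τ.t.total_chartInv, τ.s.total_chartInv] at this
  exact this

end Family.LocalTriv

/-- A `V`-map over the identity, restricted to the part over `S`. -/
def FamilyMap.restrictId {X Y : Family V B} (f : FamilyMap X Y (ContinuousMap.id B)) (S : Set B) :
    FamilyMap (X.restrict S) (Y.restrict S) (ContinuousMap.id S) where
  total := ⟨fun x => ⟨f.total x.1, (f.p_total x.1).symm ▸ x.2⟩,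
    (f.total.continuous.comp continuous_subtype_val).subtype_mk _⟩
  hom b := f.hom b.1
  total_chartInv b v := Subtype.ext (f.total_chartInv b.1 v)

theorem Family.IsBundle.of_inverse {X Y : Family V B} (hX : X.IsBundle)
    (f : FamilyMap X Y (ContinuousMap.id B)) (g : FamilyMap Y X (ContinuousMap.id B))
    (hgf : ∀ x, g.total (f.total x) = x) (hfg : ∀ y, f.total (g.total y) = y) : Y.IsBundle := by
  intro b
  obtain ⟨U, hU, E, ⟨e⟩⟩ := hX b
  let i : (Y.restrict U).toVTop ≅ (X.restrict U).toVTop :=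
    { hom := (g.restrictId U).toHom
      inv := (f.restrictId U).toHom
      hom_inv_id := VTop.hom_ext fun y => Subtype.ext (hfg y.1)
      inv_hom_id := VTop.hom_ext fun x => Subtype.ext (hgf x.1) }
  exact ⟨U, hU, E, ⟨i ≪≫ e⟩⟩

/-- The total space of a family over a `T1` base is `T1`. -/
theorem Family.t1Space [T1Space B] (X : Family V B) : T1Space X.total := by
  rw [t1Space_iff_exists_open]
  intro x y hxy
  by_cases h : X.p x = X.p y
  · obtain ⟨v, hv⟩ := X.exists_chartInv x
    obtain ⟨w, hw⟩ : ∃ w, X.chartInv (X.p x) w = y := h ▸ X.exists_chartInv y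
    have hvw : v ≠ w := by rintro rfl; exact hxy (hv.symm.trans hw)
    obtain ⟨O, hO, hvO, hwO⟩ := t1Space_iff_exists_open.1 inferInstance hvw
    obtain ⟨O', hO', rfl⟩ := (X.isEmbedding _).isInducing.isOpen_iff.1 hO
    exact ⟨O', hO', by rwa [← hv], by rwa [← hw]⟩
  · obtain ⟨O, hO, hx, hy⟩ := t1Space_iff_exists_open.1 ‹T1Space B› h
    exact ⟨X.p ⁻¹' O, hO.preimage X.p.continuous, hx, hy⟩

theorem Family.IsBundle.t2Space [T2Space B] {X : Family V B} (hX : X.IsBundle) :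
    T2Space X.total := by
  refine ⟨fun x y hxy => ?_⟩
  by_cases h : X.p x = X.p y
  · obtain ⟨τ⟩ := hX.exists_localTriv (X.p x)
    have hyU : X.p y ∈ τ.U := h ▸ τ.mem
    have hne : τ.s.total ⟨x, τ.mem⟩ ≠ τ.s.total ⟨y, hyU⟩ := fun heq => by
      have h1 := (τ.t_s ⟨x, τ.mem⟩).symm.trans ((congrArg τ.t.total heq).trans (τ.t_s ⟨y, hyU⟩))
      exact hxy (congrArg (fun x : {x : X.total // X.p x ∈ τ.U} => x.1) h1)
    have : T2Space (Family.product τ.U τ.E).total :=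
      inferInstanceAs (T2Space (τ.U × τ.E.space))
    obtain ⟨O, O', hO, hO', hx, hy, hd⟩ := t2_separation hne
    have hop : IsOpenEmbedding (Subtype.val : {x : X.total // X.p x ∈ τ.U} → X.total) :=
      (τ.isOpen.preimage X.p.continuous).isOpenEmbedding_subtypeVal
    refine ⟨Subtype.val '' (τ.s.total ⁻¹' O), Subtype.val '' (τ.s.total ⁻¹' O'),
      hop.isOpenMap _ (hO.preimage τ.s.total.continuous),
      hop.isOpenMap _ (hO'.preimage τ.s.total.continuous), ⟨_, hx, rfl⟩, ⟨_, hy, rfl⟩, ?_⟩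
    exact (disjoint_image_iff Subtype.val_injective).2 (hd.preimage _)
  · obtain ⟨O, O', hO, hO', hx, hy, hd⟩ := t2_separation h
    exact ⟨X.p ⁻¹' O, X.p ⁻¹' O', hO.preimage X.p.continuous, hO'.preimage X.p.continuous, hx, hy,
      hd.preimage _⟩

end Families

/-! ### Images of vector bundles -/

section Image

variable {V W : StructureCategory.{u}} {ψ : V.Obj ⥤ W.Obj} {B Z : Type u}
  [TopologicalSpace B] [TopologicalSpace Z]

namespace ImageTotal

theorem continuous_toProduct (hψ : IsContinuousFunctor ψ) (Z : Type u) [TopologicalSpace Z]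
    (E : V.Obj) : Continuous fun x : ImageTotal ψ (Family.product Z E) =>
      ((x.pt, x.vec) : Z × (ψ.obj E).space) := by
  refine continuous_pt.prodMk (continuous_of_push fun F b α b' α' h w w' hw => ?_)
  exact tendsto_lin_apply ((continuous_lin.tendsto _).comp
    (((hψ _ _).tendsto _).comp h.tendsto_hom_product)) hw

theorem continuous_ofProduct (Z : Type u) [TopologicalSpace Z] [SequentialSpace Z] (E : V.Obj) :
    Continuous fun q : Z × (ψ.obj E).space => (⟨q.1, q.2⟩ : ImageTotal ψ (Family.product Z E)) := by
  refine continuous_of_seq_prod fun z z' w w' hz hw => ?_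
  have := tendsto_push (ψ := ψ) ((FamilyMap.id (Family.product (V := V) Z E)).conv_of_product hz) hw
  refine (this.congr fun i => ?_).trans (le_of_eq (congrArg 𝓝 ?_))
  · exact push_id (Family.product Z E) (z i) (w i)
  · exact push_id (Family.product Z E) z' w'

end ImageTotal

/-- Over a sequential base, `ψ X` is a vector bundle for each vector bundle `X`. -/
theorem Family.IsBundle.image [T1Space B] [SequentialSpace B] (hψ : IsContinuousFunctor ψ)
    {X : Family V B} (hX : X.IsBundle) : (X.image hψ).IsBundle := by
  intro b
  obtain ⟨τ⟩ := hX.exists_localTriv b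
  have := sequentialSpace_of_isOpen τ.isOpen
  refine ⟨τ.U, τ.isOpen.mem_nhds τ.mem, ψ.obj τ.E, ⟨⟨?_, ?_, ?_, ?_⟩⟩⟩
  · exact VTop.Hom.mk (ContinuousMap.id τ.U)
      { total := ⟨_, (ImageTotal.continuous_toProduct hψ τ.U τ.E).comp
          ((ImageTotal.map τ.s).continuous.comp
            (ImageTotal.continuous_ofRestrict_of_isOpen X τ.isOpen))⟩
        hom := fun c => ψ.map (τ.s.hom c)
        total_chartInv := fun _ _ => rfl }
  · exact VTop.Hom.mk (ContinuousMap.id τ.U)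
      { total := ⟨_, (ImageTotal.continuous_toRestrict X).comp
          ((ImageTotal.map τ.t).continuous.comp (ImageTotal.continuous_ofProduct τ.U τ.E))⟩
        hom := fun c => ψ.map (τ.t.hom c)
        total_chartInv := fun _ _ => rfl }
  · refine VTop.hom_ext fun x => ?_
    obtain ⟨⟨c, w⟩, hc⟩ := x
    refine Subtype.ext ?_
    change ImageTotal.push X (τ.t.hom ⟨c, hc⟩) (lin (ψ.map (τ.s.hom ⟨c, hc⟩)) w) = ⟨c, w⟩
    refine (ImageTotal.push_comp X (τ.s.hom ⟨c, hc⟩) (τ.t.hom ⟨c, hc⟩) w).symm.trans ?_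
    exact (congrArg (fun α => ImageTotal.push X α w) (τ.s_hom_comp_t_hom ⟨c, hc⟩)).trans
      (ImageTotal.push_id X c w)
  · refine VTop.hom_ext fun x => ?_
    obtain ⟨c, w⟩ := x
    refine Prod.ext rfl ?_
    change lin (ψ.map (τ.s.hom c)) (lin (ψ.map (τ.t.hom c)) w) = w
    exact congrArg (fun α => lin α w) ((ψ.map_comp (τ.t.hom c) (τ.s.hom c)).symm.trans
      ((congrArg ψ.map (τ.t_hom_comp_s_hom c)).trans (ψ.map_id _)))

/-- For a vector bundle `X` over a sequential base, `ψ` carries all `V`-maps from product families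
to `X` to continuous maps, whatever the base of the product family. -/
theorem ImageTotal.continuous_of_product [T1Space B] [SequentialSpace B]
    (hψ : IsContinuousFunctor ψ) {X : Family V B} (hX : X.IsBundle) {E : V.Obj} {φ : C(Z, B)}
    (t : FamilyMap (Family.product Z E) X φ) :
    Continuous fun q : Z × (ψ.obj E).space => push X (t.hom q.1) q.2 := by
  rw [continuous_iff_continuousAt]
  rintro ⟨z₀, w₀⟩
  obtain ⟨τ⟩ := hX.exists_localTriv (φ z₀)
  have := sequentialSpace_of_isOpen τ.isOpen
  let N : Set Z := φ ⁻¹' τ.U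
  have hN : IsOpen N := τ.isOpen.preimage φ.continuous
  have hop : IsOpenEmbedding (Prod.map Subtype.val id :
      N × (ψ.obj E).space → Z × (ψ.obj E).space) :=
    hN.isOpenEmbedding_subtypeVal.prodMap .id
  let φ' : N → τ.U := fun z => ⟨φ z.1, z.2⟩
  have hφ' : Continuous φ' := (φ.continuous.comp continuous_subtype_val).subtype_mk _
  -- in the trivialization, the given map is described by a continuous map to `hom(E, τ.E)`
  let β : N → (E ⟶ τ.E) := fun z => t.hom z.1 ≫ τ.s.hom (φ' z)
  have hβ : Continuous β := by
    rw [isInducing_lin.continuous_iff, continuous_iff_continuousAt]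
    intro z
    refine tendsto_lin_of_pointwise fun v => ?_
    have hmem : ∀ z : N, X.p (t.total (z.1, v)) ∈ τ.U := fun z => by
      have h1 : X.p (t.total (z.1, v)) = φ z.1 := t.p_total (z.1, v)
      exact h1 ▸ z.2
    have hc : Continuous fun z : N => (τ.s.total ⟨t.total (z.1, v), hmem z⟩).2 :=
      continuous_snd.comp (τ.s.total.continuous.comp
        ((t.total.continuous.comp (continuous_subtype_val.prodMk continuous_const)).subtype_mk _))
    have heq : ∀ z : N, (τ.s.total ⟨t.total (z.1, v), hmem z⟩).2 = lin (β z) v := fun z => by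
      have h1 : (⟨t.total (z.1, v), hmem z⟩ : (X.restrict τ.U).total) =
          (X.restrict τ.U).chartInv (φ' z) (lin (t.hom z.1) v) :=
        Subtype.ext (t.total_chartInv z.1 v)
      exact congrArg (fun q : τ.U × τ.E.space => q.2)
        ((congrArg τ.s.total h1).trans (τ.s.total_chartInv (φ' z) (lin (t.hom z.1) v)))
    exact (hc.congr heq).continuousAt
  have hcont : Continuous fun q : N × (ψ.obj E).space =>
      push (ψ := ψ) X (τ.t.hom (φ' q.1)) (lin (ψ.map (β q.1)) q.2) := by
    have h1 := continuous_subtype_val.comp ((ImageTotal.continuous_toRestrict (ψ := ψ) X).comp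
      ((ImageTotal.map τ.t).continuous.comp (ImageTotal.continuous_ofProduct τ.U τ.E)))
    have h2 : Continuous fun q : N × (ψ.obj E).space =>
        ((φ' q.1, lin (ψ.map (β q.1)) q.2) : τ.U × (ψ.obj τ.E).space) :=
      (hφ'.comp continuous_fst).prodMk (continuous_lin_apply.comp
        ((continuous_lin.comp ((hψ _ _).comp (hβ.comp continuous_fst))).prodMk continuous_snd))
    exact h1.comp h2
  refine (hop.continuousAt_iff (x := (⟨z₀, τ.mem⟩, w₀))).1 (Continuous.continuousAt ?_)
  refine hcont.congr fun q => ?_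
  refine (push_comp X (β q.1) (τ.t.hom (φ' q.1)) q.2).symm.trans ?_
  refine congrArg (fun α : E ⟶ X.fiber (φ q.1.1) => push X α q.2) ?_
  change (t.hom q.1.1 ≫ τ.s.hom (φ' q.1)) ≫ τ.t.hom (φ' q.1) = t.hom q.1.1
  exact (Category.assoc _ _ _).trans ((congrArg (t.hom q.1.1 ≫ ·)
    (τ.s_hom_comp_t_hom (φ' q.1))).trans (Category.comp_id _))

/-- If all fibers of the `W`-families are literally the images of the fibers of the `V`-families,
then so are the morphisms. -/
theorem mapImage_of_hom_eq {B' : Type u} [TopologicalSpace B'] {X : Family V B}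
    {X' : Family V B'} {Y : Family W B} {Y' : Family W B'} {φ : C(B, B')}
    {h : FibersImage ψ X Y} {h' : FibersImage ψ X' Y'} {f : FamilyMap X X' φ}
    {f' : FamilyMap Y Y' φ} (hf : ∀ b, HEq (f'.hom b) (ψ.map (f.hom b))) :
    MapImage ψ h h' f f' := by
  intro b
  have aux : ∀ {A A' D D' : W.Obj} (hA : A = A') (hD : D = D') (k : A ⟶ D) (k' : A' ⟶ D'),
      HEq k k' → k = eqToHom hA ≫ k' ≫ eqToHom hD.symm := by
    rintro A _ D _ rfl rfl k k' h
    simpa using eq_of_heq h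
  exact aux (h b) (h' (φ b)) _ _ (hf b)

theorem productMapsImage_image [T1Space B] [SequentialSpace B] (hψ : IsContinuousFunctor ψ)
    {X : Family V B} (hX : X.IsBundle) : ProductMapsImage ψ X (X.image hψ) :=
  ⟨fun _ => rfl, fun _ _ _ _ t => ⟨
    { total := ⟨_, ImageTotal.continuous_of_product hψ hX t⟩
      hom := fun z => ψ.map (t.hom z)
      total_chartInv := fun _ _ => rfl },
    mapImage_of_hom_eq fun _ => HEq.rfl⟩⟩

theorem productMapsImage_restrict [T1Space B] (hψ : IsContinuousFunctor ψ) {X : Family V B}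
    {S : Set B} [SequentialSpace S] (hX : (X.restrict S).IsBundle) :
    ProductMapsImage ψ (X.restrict S) ((X.image hψ).restrict S) :=
  ⟨fun _ => rfl, fun _ _ _ _ t => ⟨
    { total := ⟨_, (ImageTotal.continuous_toRestrict X).comp
        (ImageTotal.continuous_of_product hψ hX t)⟩
      hom := fun z => ψ.map (t.hom z)
      total_chartInv := fun _ _ => rfl },
    mapImage_of_hom_eq fun _ => HEq.rfl⟩⟩

/-- If `X|S` is a vector bundle over a closed sequential subspace `S`, then so is `(ψ X)|S`. -/
theorem Family.IsBundle.image_restrict [T1Space B] (hψ : IsContinuousFunctor ψ)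
    {X : Family V B} {S : Set B} [SequentialSpace S] (hS : IsClosed S)
    (hX : (X.restrict S).IsBundle) : ((X.image hψ).restrict S).IsBundle := by
  refine (hX.image hψ).of_inverse (Y := (X.image hψ).restrict S)
    { total := ⟨_, ImageTotal.continuous_toRestrict X⟩
      hom := fun b => 𝟙 (ψ.obj (X.fiber b.1))
      total_chartInv := fun _ _ => rfl }
    { total := ⟨_, ImageTotal.continuous_ofRestrict_of_isClosed X hS⟩
      hom := fun b => 𝟙 (ψ.obj (X.fiber b.1))
      total_chartInv := fun _ _ => rfl }
    (fun _ => rfl) (fun _ => rfl)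

end Image

/-! ### Attaching spaces -/

section Attachment

variable {M X F : Type u} [TopologicalSpace M] [TopologicalSpace X] [TopologicalSpace F]
  {A : Set M} {a : C(A, X)} {c : C(M, F)} {i : C(X, F)}

/-- The space `F` is `M ∪_a X`, in explicit terms: the disjoint union of `X` and `M \ A` as a set,
with the quotient topology. -/
structure IsAttachment (A : Set M) (a : C(A, X)) (c : C(M, F)) (i : C(X, F)) : Prop where
  comm : ∀ x : A, c x = i (a x)
  inj_i : Function.Injective i
  inj : ∀ m ∉ A, ∀ m' ∉ A, c m = c m' → m = m'
  ne : ∀ m ∉ A, ∀ x, c m ≠ i x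
  cover : ∀ y, (∃ x, i x = y) ∨ ∃ m ∉ A, c m = y
  isClosed_of : ∀ C : Set F, IsClosed (c ⁻¹' C) → IsClosed (i ⁻¹' C) → IsClosed C

theorem isAttachment_of_isPushout (hi : Function.Injective i)
    (h : IsPushout (TopCat.ofHom (⟨Subtype.val, continuous_subtype_val⟩ : C(A, M)))
      (TopCat.ofHom a) (TopCat.ofHom c) (TopCat.ofHom i)) : IsAttachment A a c i := by
  classical
  have hdesc : ∀ {G : Type u} [TopologicalSpace G] (f : C(M, G)) (g : C(X, G)),
      (∀ x : A, f x = g (a x)) → ∃ k : C(F, G), (∀ m, k (c m) = f m) ∧ ∀ x, k (i x) = g x := by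
    intro G _ f g hfg
    have w : TopCat.ofHom (⟨Subtype.val, continuous_subtype_val⟩ : C(A, M)) ≫ TopCat.ofHom f =
        TopCat.ofHom a ≫ TopCat.ofHom g := by
      ext x; exact hfg x
    refine ⟨(h.desc _ _ w).hom, fun m => ?_, fun x => ?_⟩
    · exact congrArg (fun k : TopCat.of M ⟶ TopCat.of G => k.hom m) (h.inl_desc _ _ w)
    · exact congrArg (fun k : TopCat.of X ⟶ TopCat.of G => k.hom x) (h.inr_desc _ _ w)
  have huniq : ∀ {G : Type u} [TopologicalSpace G] (k k' : C(F, G)),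
      (∀ m, k (c m) = k' (c m)) → (∀ x, k (i x) = k' (i x)) → k = k' := by
    intro G _ k k' h1 h2
    have : TopCat.ofHom k = TopCat.ofHom k' := by
      apply h.hom_ext
      · ext m; exact h1 m
      · ext x; exact h2 x
    simpa using congrArg TopCat.Hom.hom this
  have hcomm : ∀ x : A, c x = i (a x) := fun x =>
    congrArg (fun k : TopCat.of A ⟶ TopCat.of F => k.hom x) h.w
  -- a test map to an indiscrete space separates the points of `M \ A` from each other and from `X`
  obtain ⟨s, hs⟩ : ∃ s : F → Option M, (∀ m, s (c m) = if m ∈ A then none else some m) ∧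
      ∀ x, s (i x) = none := by
    let : TopologicalSpace (Option M) := ⊤
    obtain ⟨k, hk⟩ := hdesc (G := Option M) ⟨fun m => if m ∈ A then none else some m,
      continuous_top⟩ ⟨fun _ => none, continuous_top⟩ (fun x => by simp)
    exact ⟨k, hk⟩
  have hcover : ∀ y, (∃ x, i x = y) ∨ ∃ m, c m = y := by
    let : TopologicalSpace (ULift.{u} Prop) := ⊤
    have := huniq (G := ULift.{u} Prop) ⟨fun y => ⟨(∃ x, i x = y) ∨ ∃ m, c m = y⟩, continuous_top⟩
      ⟨fun _ => ⟨True⟩, continuous_top⟩ (fun m => by simp) (fun x => by simp)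
    intro y
    have := congrArg (fun k : C(F, ULift.{u} Prop) => (k y).down) this
    simpa using this
  refine ⟨hcomm, hi, ?_, ?_, ?_, ?_⟩
  · intro m hm m' hm' heq
    have := congrArg s heq
    rw [hs.1, hs.1, if_neg hm, if_neg hm'] at this
    exact Option.some_injective _ this
  · intro m hm x heq
    have := congrArg s heq
    rw [hs.1, hs.2, if_neg hm] at this
    exact absurd this (by simp)
  · intro y
    rcases hcover y with hy | ⟨m, hm⟩
    · exact Or.inl hy
    · by_cases hmA : m ∈ A
      · exact Or.inl ⟨a ⟨m, hmA⟩, (hcomm ⟨m, hmA⟩).symm.trans hm⟩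
      · exact Or.inr ⟨m, hmA, hm⟩
  · intro C h1 h2
    -- the open sets are the continuous maps to the Sierpinski space
    obtain ⟨k, hk⟩ := hdesc (G := ULift.{u} Prop)
      ⟨fun m => ⟨c m ∉ C⟩, continuous_uliftUp.comp (continuous_Prop.2 h1.isOpen_compl)⟩
      ⟨fun x => ⟨i x ∉ C⟩, continuous_uliftUp.comp (continuous_Prop.2 h2.isOpen_compl)⟩
      (fun x => by simp [hcomm])
    have hk' : ∀ y, (k y).down ↔ y ∉ C := fun y => by
      rcases hcover y with ⟨x, rfl⟩ | ⟨m, rfl⟩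
      · rw [hk.2]; rfl
      · rw [hk.1]; rfl
    have := continuous_Prop.1 (continuous_uliftDown.comp k.continuous)
    rw [← isOpen_compl_iff]
    convert this using 1
    ext y
    exact (hk' y).symm

namespace IsAttachment

variable (h : IsAttachment A a c i)
include h

theorem exists_desc {G : Type u} [TopologicalSpace G] (f : C(M, G)) (g : C(X, G))
    (hfg : ∀ x : A, f x = g (a x)) :
    ∃ k : C(F, G), (∀ m, k (c m) = f m) ∧ ∀ x, k (i x) = g x := by
  have : ∀ y, ∃ z, (∀ m, c m = y → z = f m) ∧ ∀ x, i x = y → z = g x := by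
    intro y
    rcases h.cover y with ⟨x, rfl⟩ | ⟨m, hm, rfl⟩
    · refine ⟨g x, fun m hmx => ?_, fun x' hx' => by rw [h.inj_i hx']⟩
      by_cases hm : m ∈ A
      · rw [hfg ⟨m, hm⟩, h.inj_i ((h.comm ⟨m, hm⟩).symm.trans hmx)]
      · exact absurd hmx (h.ne m hm x)
    · refine ⟨f m, fun m' hm' => ?_, fun x hx => absurd hx.symm (h.ne m hm x)⟩
      by_cases hA : m' ∈ A
      · exact absurd (hm'.symm.trans (h.comm ⟨m', hA⟩)) (h.ne m hm _)
      · rw [h.inj m' hA m hm hm']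
  choose k hk using this
  refine ⟨⟨k, ?_⟩, fun m => (hk _).1 m rfl, fun x => (hk _).2 x rfl⟩
  rw [continuous_iff_isClosed]
  intro C hC
  refine h.isClosed_of _ ?_ ?_
  · convert hC.preimage f.continuous using 1
    ext m
    simp only [mem_preimage, (hk (c m)).1 m rfl]
  · convert hC.preimage g.continuous using 1
    ext x
    simp only [mem_preimage, (hk (i x)).2 x rfl]

theorem isClosedEmbedding (hA : IsClosed A) : IsClosedEmbedding i := by
  refine .of_continuous_injective_isClosedMap i.continuous h.inj_i fun C hC => ?_
  refine h.isClosed_of _ ?_ ?_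
  · convert (hC.preimage a.continuous).trans hA using 1
    ext m
    constructor
    · rintro ⟨x, hx, hxm⟩
      by_cases hm : m ∈ A
      · refine ⟨⟨m, hm⟩, ?_, rfl⟩
        rwa [mem_preimage, ← h.inj_i (hxm.trans (h.comm ⟨m, hm⟩))]
      · exact absurd hxm.symm (h.ne m hm x)
    · rintro ⟨m, hm, rfl⟩
      exact ⟨_, hm, (h.comm m).symm⟩
  · rwa [preimage_image_eq _ h.inj_i]

/-- A closed subset of `M` that meets `A` in finitely many points, up to identifications, has a
closed image. -/
theorem isClosed_image [T1Space F] {C : Set M} (hC : IsClosed C) (hCA : (c '' (C ∩ A)).Finite) :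
    IsClosed (c '' C) := by
  refine h.isClosed_of _ ?_ ?_
  · have : c ⁻¹' (c '' C) = C ∪ c ⁻¹' (c '' (C ∩ A)) := by
      ext m
      constructor
      · rintro ⟨m', hm', heq⟩
        by_cases hA' : m' ∈ A
        · exact Or.inr ⟨m', ⟨hm', hA'⟩, heq⟩
        · by_cases hA : m ∈ A
          · exact absurd (heq.trans (h.comm ⟨m, hA⟩)) (h.ne m' hA' _)
          · exact Or.inl (h.inj _ hA' _ hA heq ▸ hm')
      · rintro (hm | ⟨m', hm', heq⟩)
        · exact ⟨m, hm, rfl⟩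
        · exact ⟨m', hm'.1, heq⟩
    rw [this]
    exact hC.union (hCA.isClosed.preimage c.continuous)
  · have : i ⁻¹' (c '' C) = i ⁻¹' (c '' (C ∩ A)) := by
      ext x
      constructor
      · rintro ⟨m, hm, heq⟩
        by_cases hA : m ∈ A
        · exact ⟨m, ⟨hm, hA⟩, heq⟩
        · exact absurd heq (h.ne m hA x)
      · rintro ⟨m, hm, heq⟩
        exact ⟨m, hm.1, heq⟩
    rw [this]
    exact hCA.isClosed.preimage i.continuous

theorem t1Space [T1Space M] [T1Space X] (hA : IsClosed A) : T1Space F := by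
  refine ⟨fun y => ?_⟩
  rcases h.cover y with ⟨x, rfl⟩ | ⟨m, hm, rfl⟩
  · simpa using (h.isClosedEmbedding hA).isClosedMap {x} isClosed_singleton
  · refine h.isClosed_of _ ?_ ?_
    · convert isClosed_singleton (x := m) using 1
      ext m'
      refine ⟨fun hm' => ?_, fun hm' => congrArg c hm'⟩
      by_cases hA' : m' ∈ A
      · exact absurd (hm'.symm.trans (h.comm ⟨m', hA'⟩)) (h.ne m hm _)
      · exact h.inj _ hA' _ hm hm'
    · convert isClosed_empty using 1
      ext x
      exact ⟨fun hx => h.ne m hm x (Eq.symm hx), fun hx => hx.elim⟩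

/-- The image of a locally finite sequence in `M \ A` does not converge. -/
theorem not_tendsto [T1Space M] [T1Space F] {y : ℕ → M} (hy : ∀ n, y n ∉ A)
    (hlf : LocallyFinite fun n => ({y n} : Set M)) (x : F) :
    ¬ Tendsto (fun n => c (y n)) atTop (𝓝 x) := by
  intro hx
  have hcl : IsClosed (c '' (y '' {n | c (y n) ≠ x})) := by
    refine h.isClosed_image (isClosed_image_of_locallyFinite hlf _) ?_
    convert finite_empty
    rw [image_eq_empty]
    ext m
    refine ⟨?_, fun hm => hm.elim⟩
    rintro ⟨⟨n, -, rfl⟩, hA⟩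
    exact hy n hA
  have hev : ∀ᶠ n in atTop, c (y n) = x := by
    have := hx.eventually (hcl.isOpen_compl.mem_nhds (x := x) (by
      rintro ⟨_, ⟨n, hn, rfl⟩, heq⟩
      exact hn heq))
    filter_upwards [this] with n hn
    by_contra hne
    exact hn ⟨y n, ⟨n, hne, rfl⟩, rfl⟩
  obtain ⟨N, hN⟩ := eventually_atTop.1 hev
  -- `c` is injective outside `A`, so that `y` would be eventually constant
  obtain ⟨U, hU, hfin⟩ := locallyFinite_singleton_iff.1 hlf (y N)
  obtain ⟨n, hn, hn'⟩ := (hfin.and (eventually_ge_atTop N)).exists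
  have : y n = y N := h.inj _ (hy n) _ (hy N) ((hN n hn').trans (hN N le_rfl).symm)
  exact hn (this ▸ mem_of_mem_nhds hU)

/-- If a sequence in `M \ A` converges to `y`, then `c y` is the only limit of its image. -/
theorem tendsto_unique [T2Space M] [T1Space F] {y : ℕ → M} (hy : ∀ n, y n ∉ A) {y' : M}
    (hlim : Tendsto y atTop (𝓝 y')) {x : F} (hx : Tendsto (fun n => c (y n)) atTop (𝓝 x)) :
    x = c y' := by
  -- either `y` takes one value infinitely often, or `x` lies outside the closed image of
  -- the tail of `y` and its limit
  by_cases hfr : ∃ᶠ n in atTop, c (y n) = x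
  · obtain ⟨σ, hσ, hσ'⟩ := extraction_of_frequently_atTop hfr
    have hconst : ∀ n, y (σ n) = y (σ 0) := fun n =>
      h.inj _ (hy _) _ (hy _) ((hσ' n).trans (hσ' 0).symm)
    have h1 : Tendsto (fun n => y (σ n)) atTop (𝓝 y') := hlim.comp hσ.tendsto_atTop
    simp only [hconst] at h1
    rw [← tendsto_const_nhds_iff.1 h1, hσ' 0]
  · by_contra hne
    rw [not_frequently] at hfr
    obtain ⟨N, hN⟩ := eventually_atTop.1 hfr
    have hlim' : Tendsto (fun n => y (n + N)) atTop (𝓝 y') := hlim.comp (tendsto_add_atTop_nat N)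
    have hcl : IsClosed (c '' (insert y' (range fun n => y (n + N)))) := by
      refine h.isClosed_image hlim'.isCompact_insert_range.isClosed
        ((finite_singleton (c y')).subset ?_)
      rintro _ ⟨m, ⟨rfl | ⟨n, rfl⟩, hA⟩, rfl⟩
      · rfl
      · exact absurd hA (hy _)
    have hmem : x ∈ c '' (insert y' (range fun n => y (n + N))) :=
      hcl.mem_of_tendsto (hx.comp (tendsto_add_atTop_nat N)) (Eventually.of_forall fun n =>
        ⟨y (n + N), Or.inr ⟨n, rfl⟩, rfl⟩)
    obtain ⟨m, rfl | ⟨n, rfl⟩, heq⟩ := hmem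
    · exact hne heq.symm
    · exact hN (n + N) (Nat.le_add_left _ _) heq

end IsAttachment

end Attachment

/-! ### The filtration of a stratified space -/

namespace StratifiedSpace

variable (B : StratifiedSpace.{u})

instance (n : ℕ) : T2Space (B.M n) := (B.isCWPair n).1

theorem isClosed_A (n : ℕ) : IsClosed (B.A n) := by
  obtain ⟨_, _, S, hS⟩ := B.isCWPair n
  exact hS ▸ S.closed'

instance (n : ℕ) : SequentialSpace (B.M n) := by
  obtain ⟨_, _, -⟩ := B.isCWPair n
  exact sequentialSpace_of_cwComplex

instance : SequentialSpace (B.filt 0) := by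
  obtain ⟨_, ⟨_⟩⟩ := B.isCWSpace_zero
  exact sequentialSpace_of_cwComplex

theorem isAttachment (n : ℕ) : IsAttachment (B.A n) (B.attach n) (B.char n)
    ⟨Set.inclusion (B.filt_le n), _root_.continuous_inclusion (B.filt_le n)⟩ :=
  isAttachment_of_isPushout (Set.inclusion_injective (B.filt_le n)) (B.isPushout n)

theorem filt_mono : Monotone B.filt := monotone_nat_of_le_succ B.filt_le

theorem isClosed_preimage_filt (n m : ℕ) : IsClosed ((↑) ⁻¹' B.filt n : Set (B.filt m)) := by
  rcases le_total m n with hmn | hnm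
  · convert isClosed_univ
    ext x
    exact ⟨fun _ => trivial, fun _ => B.filt_mono hmn x.2⟩
  · induction m, hnm using Nat.le_induction with
    | base =>
      convert isClosed_univ
      ext x
      exact ⟨fun _ => trivial, fun _ => x.2⟩
    | succ m hnm ih =>
      convert ((B.isAttachment m).isClosedEmbedding (B.isClosed_A m)).isClosedMap _ ih using 1
      ext x
      constructor
      · intro hx
        exact ⟨⟨x.1, B.filt_mono hnm hx⟩, hx, rfl⟩
      · rintro ⟨y, hy, rfl⟩
        exact hy

theorem isClosed_filt (n : ℕ) : IsClosed (B.filt n) := by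
  rw [B.coherent.isClosed_iff]
  rintro _ ⟨m, rfl⟩
  exact B.isClosed_preimage_filt n m

instance t1Space_filt (n : ℕ) : T1Space (B.filt n) := by
  induction n with
  | zero => have := B.isCWSpace_zero.1; infer_instance
  | succ n ih => exact (B.isAttachment n).t1Space (B.isClosed_A n)

instance : T1Space B.carrier := by
  refine ⟨fun b => ?_⟩
  rw [B.coherent.isClosed_iff]
  rintro _ ⟨m, rfl⟩
  refine Set.Finite.isClosed (Set.Subsingleton.finite ?_)
  intro x hx y hy
  exact Subtype.ext (Eq.trans hx (Eq.symm hy))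

theorem exists_mem_filt (b : B.carrier) : ∃ n, b ∈ B.filt n := by
  have : b ∈ ⋃ n, B.filt n := B.iUnion_filt ▸ mem_univ b
  simpa using this

/-- A convergent sequence is infinitely often in one stage of the filtration. -/
theorem exists_frequently_mem_filt {b : ℕ → B.carrier} {b' : B.carrier}
    (h : Tendsto b atTop (𝓝 b')) : ∃ n, ∃ᶠ i in atTop, b i ∈ B.filt n := by
  by_contra hcon
  have hev : ∀ n, ∀ᶠ i in atTop, b i ∉ B.filt n := by
    simpa only [not_exists, not_frequently] using hcon
  -- otherwise `b` meets each stage finitely often, and is locally finite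
  have hlf := locallyFinite_of_finite_inter (x := b) B.exists_mem_filt (fun S hS => ?_) fun n => ?_
  · obtain ⟨U, hU, hUb⟩ := locallyFinite_singleton_iff.1 hlf b'
    obtain ⟨i, hi, hi'⟩ := (hUb.and (h.eventually hU)).exists
    exact hi hi'
  · rw [B.coherent.isClosed_iff]
    rintro _ ⟨m, rfl⟩
    convert (hS m).preimage continuous_subtype_val using 1
    ext x; simp
  · have := hev n
    rw [← Nat.cofinite_eq_atTop, eventually_cofinite] at this
    simpa using this

end StratifiedSpace

/-! ### Push-outs of families -/

section Gluing

variable {M X : Type u} [TopologicalSpace M] [TopologicalSpace X]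

/-- The attaching space `M ∪_a X`. -/
theorem exists_isAttachment (A : Set M) (a : C(A, X)) :
    ∃ (F : Type u) (_ : TopologicalSpace F) (c : C(M, F)) (i : C(X, F)),
      IsAttachment A a c i := by
  classical
  let c : M → {m // m ∉ A} ⊕ X := fun m =>
    if h : m ∈ A then Sum.inr (a ⟨m, h⟩) else Sum.inl ⟨m, h⟩
  let i : X → {m // m ∉ A} ⊕ X := Sum.inr
  have hc1 : ∀ m (h : m ∈ A), c m = Sum.inr (a ⟨m, h⟩) := fun m h => dif_pos h
  have hc2 : ∀ m (h : m ∉ A), c m = Sum.inl ⟨m, h⟩ := fun m h => dif_neg h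
  let top : TopologicalSpace ({m // m ∉ A} ⊕ X) :=
    TopologicalSpace.coinduced c inferInstance ⊔ TopologicalSpace.coinduced i inferInstance
  have hc : @Continuous _ _ _ top c := continuous_iff_coinduced_le.2 le_sup_left
  have hi : @Continuous _ _ _ top i := continuous_iff_coinduced_le.2 le_sup_right
  refine ⟨{m // m ∉ A} ⊕ X, top, @ContinuousMap.mk _ _ _ top c hc,
    @ContinuousMap.mk _ _ _ top i hi, ?_⟩
  refine @IsAttachment.mk _ _ _ _ _ top _ _ _ _ ?_ ?_ ?_ ?_ ?_ ?_
  · exact fun x => hc1 x.1 x.2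
  · exact Sum.inr_injective
  · intro m hm m' hm' h
    have h' : c m = c m' := h
    rw [hc2 m hm, hc2 m' hm'] at h'
    exact congrArg Subtype.val (Sum.inl_injective h')
  · intro m hm x h
    have h' : c m = Sum.inr x := h
    rw [hc2 m hm] at h'
    cases h'
  · rintro (⟨m, hm⟩ | x)
    · exact Or.inr ⟨m, hm, hc2 m hm⟩
    · exact Or.inl ⟨x, rfl⟩
  · intro C h1 h2
    refine @IsClosed.mk _ top C ?_
    refine ⟨?_, ?_⟩
    · exact isOpen_coinduced.2 h1.isOpen_compl
    · exact isOpen_coinduced.2 h2.isOpen_compl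

/-- Being an attaching space is invariant under homeomorphisms of `X` and `F`. -/
theorem IsAttachment.of_inverse {X' F F' : Type u} [TopologicalSpace X'] [TopologicalSpace F]
    [TopologicalSpace F'] {A : Set M} {a : C(A, X)} {c : C(M, F)} {i : C(X, F)} {a' : C(A, X')}
    {c' : C(M, F')} {i' : C(X', F')} (h : IsAttachment A a c i) (d : C(X', X)) (d' : C(X, X'))
    (hd : ∀ x, d' (d x) = x) (hd' : ∀ x, d (d' x) = x) (e : C(F', F)) (e' : C(F, F'))
    (he : ∀ y, e' (e y) = y) (ha : ∀ x, d (a' x) = a x) (hc : ∀ m, e (c' m) = c m)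
    (hi : ∀ x, e (i' x) = i (d x)) : IsAttachment A a' c' i' := by
  have hinj : Function.Injective e := Function.LeftInverse.injective he
  have hdinj : Function.Injective d := Function.LeftInverse.injective hd
  have hc' : ∀ m, e' (c m) = c' m := fun m => by rw [← hc, he]
  have hi' : ∀ x, e' (i x) = i' (d' x) := fun x => by rw [← hd' x, ← hi, he, hd' x]
  refine ⟨?_, ?_, ?_, ?_, ?_, ?_⟩
  · intro x
    apply hinj
    rw [hc, hi, ha, h.comm]
  · intro x y hxy
    exact hdinj (h.inj_i (by rw [← hi, ← hi, hxy]))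
  · intro m hm m' hm' hmm
    exact h.inj m hm m' hm' (by rw [← hc, ← hc, hmm])
  · intro m hm x hmx
    exact h.ne m hm (d x) (by rw [← hc, ← hi, hmx])
  · intro y
    rcases h.cover (e y) with ⟨x, hx⟩ | ⟨m, hm, hmy⟩
    · exact Or.inl ⟨d' x, hinj (by rw [hi, hd', hx])⟩
    · exact Or.inr ⟨m, hm, hinj (by rw [hc, hmy])⟩
  · intro C h1 h2
    have : IsClosed (e' ⁻¹' C) := by
      refine h.isClosed_of _ ?_ ?_
      · rw [← preimage_comp]
        convert h1 using 1
        ext m; simp [hc']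
      · rw [← preimage_comp]
        convert h2.preimage d'.continuous using 1
        ext m; simp [hi']
    convert this.preimage e.continuous using 1
    ext y; simp [he]

end Gluing

section FamilyPushout

variable {V : StructureCategory.{u}} {MB XB FB : Type u} [TopologicalSpace MB]
  [TopologicalSpace XB] [TopologicalSpace FB] {A : Set MB} {a₀ : C(A, XB)} {c₀ : C(MB, FB)}
  {i₀ : C(XB, FB)} {M : Family V MB} {X : Family V XB} {F : Family V FB}

/-- The map of total spaces underlying a `V`-map on a restriction `M|A`. -/
def FamilyMap.totalOn (a : FamilyMap (M.restrict A) X a₀) : C(M.p ⁻¹' A, X.total) := a.total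

theorem exists_desc_of_isAttachment {a : FamilyMap (M.restrict A) X a₀} {c : FamilyMap M F c₀}
    {i : FamilyMap X F i₀} (h₀ : IsAttachment A a₀ c₀ i₀)
    (h : IsAttachment (M.p ⁻¹' A) a.totalOn c.total i.total) (hi : ∀ b, IsIso (i.hom b))
    (hc : ∀ m ∉ A, IsIso (c.hom m)) {GB : Type u} [TopologicalSpace GB] {G : Family V GB}
    {f₀ : C(MB, GB)} (f : FamilyMap M G f₀) {g₀ : C(XB, GB)} (g : FamilyMap X G g₀)
    (hfg : ∀ x : (M.restrict A).total, f.total x.1 = g.total (a.total x)) :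
    ∃ (k₀ : C(FB, GB)) (k : FamilyMap F G k₀), (∀ x, k.total (c.total x) = f.total x) ∧
      ∀ x, k.total (i.total x) = g.total x := by
  have hfg₀ : ∀ x : A, f₀ x = g₀ (a₀ x) := fun x => by
    have h1 := congrArg G.p (hfg ((M.restrict A).chartInv x 0))
    have h2 : f₀ (M.p ((M.restrict A).chartInv x 0).1) = g₀ (X.p (a.total _)) :=
      (f.p_total _).symm.trans (h1.trans (g.p_total _))
    have h3 : M.p ((M.restrict A).chartInv x 0).1 = x := M.p_chartInv x.1 0
    have h4 : X.p (a.total ((M.restrict A).chartInv x 0)) = a₀ x := by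
      rw [a.p_total, (M.restrict A).p_chartInv]
    rwa [h3, h4] at h2
  obtain ⟨k₀, hk₀c, hk₀i⟩ := h₀.exists_desc f₀ g₀ hfg₀
  obtain rfl : k₀.comp c₀ = f₀ := ContinuousMap.ext hk₀c
  obtain rfl : k₀.comp i₀ = g₀ := ContinuousMap.ext hk₀i
  obtain ⟨k, hkc, hki⟩ := h.exists_desc f.total g.total hfg
  refine ⟨k₀, FamilyMap.ofExists k ?_, hkc, hki⟩
  intro b
  rcases h₀.cover b with ⟨x, rfl⟩ | ⟨m, hm, rfl⟩
  · have := hi x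
    refine ⟨inv (i.hom x) ≫ g.hom x, fun v => ?_⟩
    have h1 : lin (i.hom x) (lin (inv (i.hom x)) v) = v :=
      congrArg (fun α => lin α v) (IsIso.inv_hom_id (i.hom x))
    conv_lhs => rw [← h1, ← i.total_chartInv, hki, g.total_chartInv]
    rfl
  · have := hc m hm
    refine ⟨inv (c.hom m) ≫ f.hom m, fun v => ?_⟩
    have h1 : lin (c.hom m) (lin (inv (c.hom m)) v) = v :=
      congrArg (fun α => lin α v) (IsIso.inv_hom_id (c.hom m))
    conv_lhs => rw [← h1, ← c.total_chartInv, hkc, f.total_chartInv]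
    rfl

/-- A commutative square of families is a push-out if it is an attaching square of base spaces and
of total spaces, and the maps of fibers are isomorphisms where they have to be. -/
theorem isPushout_of_isAttachment {a : FamilyMap (M.restrict A) X a₀} {c : FamilyMap M F c₀}
    {i : FamilyMap X F i₀} (h₀ : IsAttachment A a₀ c₀ i₀)
    (h : IsAttachment (M.p ⁻¹' A) a.totalOn c.total i.total) (hi : ∀ b, IsIso (i.hom b))
    (hc : ∀ m ∉ A, IsIso (c.hom m)) :
    IsPushout (M.restrictVal A).toHom a.toHom c.toHom i.toHom := by
  have w : (M.restrictVal A).toHom ≫ c.toHom = a.toHom ≫ i.toHom :=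
    VTop.hom_ext fun x => h.comm x
  have hdesc : ∀ s : Limits.PushoutCocone (M.restrictVal A).toHom a.toHom,
      ∃ k : F.toVTop ⟶ s.pt, c.toHom ≫ k = s.inl ∧ i.toHom ≫ k = s.inr := by
    intro s
    obtain ⟨k₀, k, hkc, hki⟩ := exists_desc_of_isAttachment h₀ h hi hc
      (VTop.Hom.fam s.inl) (VTop.Hom.fam s.inr) (fun x =>
        congrArg (fun f : (M.restrict A).toVTop ⟶ s.pt => (VTop.Hom.fam f).total x) s.condition)
    exact ⟨VTop.Hom.mk k₀ k, VTop.hom_ext hkc, VTop.hom_ext hki⟩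
  choose k hkc hki using hdesc
  refine ⟨⟨w⟩, ⟨Limits.PushoutCocone.IsColimit.mk w k hkc hki fun s l hlc hli => ?_⟩⟩
  refine VTop.hom_ext fun y => ?_
  rcases h.cover y with ⟨x, rfl⟩ | ⟨m, -, rfl⟩
  · exact congrArg (fun f : X.toVTop ⟶ s.pt => (VTop.Hom.fam f).total x)
      (hli.trans (hki s).symm)
  · exact congrArg (fun f : M.toVTop ⟶ s.pt => (VTop.Hom.fam f).total m)
      (hlc.trans (hkc s).symm)

/-- Families can be glued along a `V`-map over an attaching map. -/
theorem exists_glued [T1Space MB] [T1Space XB] (hA : IsClosed A)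
    (h₀ : IsAttachment A a₀ c₀ i₀) (a : FamilyMap (M.restrict A) X a₀) :
    ∃ (P : Family V FB) (c : FamilyMap M P c₀) (i : FamilyMap X P i₀),
      IsAttachment (M.p ⁻¹' A) a.totalOn c.total i.total ∧ (∀ b, IsIso (i.hom b)) ∧
      ∀ m ∉ A, IsIso (c.hom m) := by
  obtain ⟨P, _, c, i, h⟩ := exists_isAttachment (M.p ⁻¹' A) a.totalOn
  have hA' : IsClosed (M.p ⁻¹' A) := hA.preimage M.p.continuous
  have := M.t1Space
  have := X.t1Space
  have := h.t1Space hA'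
  obtain ⟨p, hpc, hpi⟩ := h.exists_desc (c₀.comp M.p) (i₀.comp X.p) fun x => by
    have h1 : X.p (a.totalOn x) = a₀ ⟨M.p x.1, x.2⟩ := a.p_total x
    change c₀ (M.p x.1) = i₀ (X.p (a.totalOn x))
    rw [h1, ← h₀.comm]
  have key : ∀ b, ∃ (E : V.Obj) (ch : E.space → P), IsEmbedding ch ∧ range ch = p ⁻¹' {b} ∧
      (∀ x, i₀ x = b → ∃ g : X.fiber x ⟶ E, IsIso g ∧
        ∀ v, i (X.chartInv x v) = ch (lin g v)) ∧
      (∀ m, c₀ m = b → ∃ g : M.fiber m ⟶ E, (m ∉ A → IsIso g) ∧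
        ∀ v, c (M.chartInv m v) = ch (lin g v)) := by
    intro b
    rcases h₀.cover b with ⟨x, rfl⟩ | ⟨m, hm, rfl⟩
    · refine ⟨X.fiber x, fun v => i (X.chartInv x v),
        (h.isClosedEmbedding hA').isEmbedding.comp (X.isEmbedding x), ?_, ?_, ?_⟩
      · ext y
        constructor
        · rintro ⟨v, rfl⟩
          change p (i _) = _
          rw [hpi]
          exact congrArg i₀ (X.p_chartInv x v)
        · intro hy
          have hy : p y = i₀ x := hy
          rcases h.cover y with ⟨z, rfl⟩ | ⟨m, hm, rfl⟩
          · rw [hpi] at hy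
            obtain rfl : X.p z = x := h₀.inj_i hy
            obtain ⟨v, hv⟩ := X.exists_chartInv z
            exact ⟨v, congrArg i hv⟩
          · rw [hpc] at hy
            exact absurd hy (h₀.ne _ hm x)
      · intro x' hx'
        obtain rfl := h₀.inj_i hx'
        exact ⟨𝟙 _, inferInstance, fun v => rfl⟩
      · intro m hmx
        by_cases hm : m ∈ A
        · obtain rfl := h₀.inj_i ((h₀.comm ⟨m, hm⟩).symm.trans hmx)
          refine ⟨a.hom ⟨m, hm⟩, fun hm' => absurd hm hm', fun v => ?_⟩
          refine (h.comm ⟨M.chartInv m v, M.chartInv_mem A ⟨m, hm⟩ v⟩).trans (congrArg i ?_)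
          exact a.total_chartInv ⟨m, hm⟩ v
        · exact absurd hmx (h₀.ne m hm x)
    · have hch : IsClosedEmbedding (M.chartInv m) :=
        ⟨M.isEmbedding m, by
          rw [M.range_eq]; exact isClosed_singleton.preimage M.p.continuous⟩
      have hout : ∀ v, M.chartInv m v ∉ M.p ⁻¹' A := fun v hv => by
        rw [mem_preimage, M.p_chartInv] at hv
        exact hm hv
      refine ⟨M.fiber m, fun v => c (M.chartInv m v), ?_, ?_, ?_, ?_⟩
      · refine (IsClosedEmbedding.of_continuous_injective_isClosedMap
          (c.continuous.comp hch.continuous) ?_ fun C hC => ?_).isEmbedding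
        · exact fun v w hvw => hch.injective (h.inj _ (hout v) _ (hout w) hvw)
        · rw [image_comp]
          refine h.isClosed_image (hch.isClosedMap C hC) ?_
          convert finite_empty
          rw [image_eq_empty]
          ext y
          refine ⟨?_, fun hy => hy.elim⟩
          rintro ⟨⟨v, -, rfl⟩, hv⟩
          exact hout v hv
      · ext y
        constructor
        · rintro ⟨v, rfl⟩
          change p (c _) = _
          rw [hpc]
          exact congrArg c₀ (M.p_chartInv m v)
        · intro hy
          have hy : p y = c₀ m := hy
          rcases h.cover y with ⟨z, rfl⟩ | ⟨m', hm', rfl⟩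
          · rw [hpi] at hy
            exact absurd hy.symm (h₀.ne m hm _)
          · rw [hpc] at hy
            obtain rfl : M.p m' = m := h₀.inj _ hm' _ hm hy
            obtain ⟨v, hv⟩ := M.exists_chartInv m'
            exact ⟨v, congrArg c hv⟩
      · intro x hx
        exact absurd hx.symm (h₀.ne m hm x)
      · intro m' hmm
        by_cases hm' : m' ∈ A
        · exact absurd (hmm.symm.trans (h₀.comm ⟨m', hm'⟩)) (h₀.ne m hm _)
        · obtain rfl := h₀.inj m' hm' m hm hmm
          exact ⟨𝟙 _, fun _ => inferInstance, fun v => rfl⟩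
  choose E ch hemb hrange hX hM using key
  choose gX hgX hgX' using fun x => hX (i₀ x) x rfl
  choose gM hgM hgM' using fun m => hM (c₀ m) m rfl
  exact ⟨{ total := P, p := p, fiber := E, chartInv := ch, isEmbedding := hemb,
           range_eq := hrange },
    { total := c, hom := gM, total_chartInv := hgM' },
    { total := i, hom := gX, total_chartInv := hgX' }, h, hgX, hgM⟩

/-- A push-out of families over an attaching space is an attaching space on the level of total
spaces, and it has the fibers of `M` outside `A`. -/
theorem isAttachment_of_isPushout_family [T1Space MB] [T1Space XB] (hA : IsClosed A)
    {a : FamilyMap (M.restrict A) X a₀} {c : FamilyMap M F c₀} {i : FamilyMap X F i₀}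
    (h₀ : IsAttachment A a₀ c₀ i₀)
    (hp : IsPushout (M.restrictVal A).toHom a.toHom c.toHom i.toHom) :
    IsAttachment (M.p ⁻¹' A) a.totalOn c.total i.total ∧ ∀ m ∉ A, IsIso (c.hom m) := by
  obtain ⟨P, c', i', h, hi', hc'⟩ := exists_glued hA h₀ a
  have hp' := isPushout_of_isAttachment h₀ h hi' hc'
  obtain ⟨e, hec, hei⟩ : ∃ e : F.toVTop ≅ P.toVTop,
      c.toHom ≫ e.hom = c'.toHom ∧ i.toHom ≫ e.hom = i'.toHom :=
    ⟨hp.isoIsPushout _ _ hp', hp.inl_isoIsPushout_hom _ _ hp', hp.inr_isoIsPushout_hom _ _ hp'⟩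
  let ε : C(FB, FB) := VTop.Hom.base e.hom
  let f : FamilyMap F P ε := VTop.Hom.fam e.hom
  have hec' : ∀ x, f.total (c.total x) = c'.total x := fun x =>
    congrArg (fun k : M.toVTop ⟶ P.toVTop => (VTop.Hom.fam k).total x) hec
  have hei' : ∀ x, f.total (i.total x) = i'.total x := fun x =>
    congrArg (fun k : X.toVTop ⟶ P.toVTop => (VTop.Hom.fam k).total x) hei
  have hinv : ∀ y, (VTop.Hom.fam e.inv).total (f.total y) = y := fun y =>
    congrArg (fun k : F.toVTop ⟶ F.toVTop => (VTop.Hom.fam k).total y) e.hom_inv_id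
  have hεc : ∀ m, ε (c₀ m) = c₀ m := fun m =>
    congrArg (fun k : M.toVTop ⟶ P.toVTop => VTop.Hom.base k m) hec
  refine ⟨h.of_inverse (.id _) (.id _) (fun _ => rfl) (fun _ => rfl) f.total
    (VTop.Hom.fam e.inv).total hinv (fun _ => rfl) hec' hei', fun m hm => ?_⟩
  obtain ⟨r, hr⟩ := P.exists_hom_of_eq (hεc m) (f.hom (c₀ m))
  have := hc' m hm
  have h1 : c.hom m ≫ r = c'.hom m := by
    refine lin_injective (LinearMap.ext fun v => (P.isEmbedding (c₀ m)).injective ?_)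
    refine (hr (lin (c.hom m) v)).symm.trans ?_
    rw [← f.total_chartInv, ← c.total_chartInv, hec', c'.total_chartInv]
  refine ⟨r ≫ inv (c'.hom m), ?_, ?_⟩
  · rw [← Category.assoc, h1, IsIso.hom_inv_id]
  · refine lin_injective (LinearMap.ext fun v => (F.isEmbedding (c₀ m)).injective ?_)
    have h2 : lin (c'.hom m) (lin (inv (c'.hom m)) (lin r v)) = lin r v :=
      congrArg (fun α => lin α (lin r v)) (IsIso.inv_hom_id (c'.hom m))
    refine Function.LeftInverse.injective hinv ?_
    change f.total (F.chartInv _ (lin (c.hom m) (lin (inv (c'.hom m)) (lin r v)))) =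
      f.total (F.chartInv _ v)
    rw [← c.total_chartInv, hec', c'.total_chartInv, h2, f.total_chartInv, hr]

end FamilyPushout

/-! ### Regular functors and limits of morphisms -/

section Regular

variable {V W : StructureCategory.{u}} {ψ : V.Obj ⥤ W.Obj}

/-- Let the morphisms `γ i : E ⟶ E'` converge to a linear map `γ'`, which need not be a morphism
of `V`, and let `δ ∘ γ'` be a morphism `α` for some morphism `δ`. If `ψ` is regular, then the maps
`ψ(γ i)` converge as well, and their limit composed with `ψ(δ)` is `ψ(α)`. -/
theorem IsRegularFunctor.exists_limit (hψ : IsRegularFunctor ψ) {E E' G : V.Obj}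
    {γ : ℕ → (E ⟶ E')} {γ' : E.space →ₗ[ℝ] E'.space}
    (hγ : Tendsto (fun i => lin (γ i)) atTop (𝓝 γ')) (δ : E' ⟶ G) (α : E ⟶ G)
    (hα : (lin δ).comp γ' = lin α) {w : ℕ → (ψ.obj E).space} {w' : (ψ.obj E).space}
    (hw : Tendsto w atTop (𝓝 w')) :
    ∃ u, Tendsto (fun i => lin (ψ.map (γ i)) (w i)) atTop (𝓝 u) ∧
      lin (ψ.map δ) u = lin (ψ.map α) w' := by
  obtain ⟨ψ', hψ', heq⟩ := hψ
  have hobj : ∀ F : V.Obj, ψ'.obj (V.toClosure.obj F) = W.toClosure.obj (ψ.obj F) :=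
    fun F => Functor.congr_obj heq F
  -- `L` is `ψ'`, up to the identification of the objects
  let L : ∀ {F F' : V.Obj}, (V.toClosure.obj F ⟶ V.toClosure.obj F') →
      (W.toClosure.obj (ψ.obj F) ⟶ W.toClosure.obj (ψ.obj F')) :=
    fun {F F'} f => eqToHom (hobj F).symm ≫ ψ'.map f ≫ eqToHom (hobj F')
  have hL : ∀ {F F' : V.Obj} (f : F ⟶ F'),
      L (V.toClosure.map f) = W.toClosure.map (ψ.map f) := by
    intro F F' f
    have h1 := Functor.congr_hom heq f
    simp only [Functor.comp_map] at h1
    simp only [L, h1]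
    simp
  have hLcomp : ∀ {F F' F'' : V.Obj} (f : V.toClosure.obj F ⟶ V.toClosure.obj F')
      (g : V.toClosure.obj F' ⟶ V.toClosure.obj F''), L (f ≫ g) = L f ≫ L g := by
    intro F F' F'' f g
    simp [L]
  let γ'' : V.toClosure.obj E ⟶ V.toClosure.obj E' :=
    ⟨γ', mem_closure_of_tendsto hγ (Eventually.of_forall fun i => (γ i).2)⟩
  have h1 : Tendsto (fun i => V.toClosure.map (γ i)) atTop (𝓝 γ'') := by
    rw [isInducing_lin.tendsto_nhds_iff]
    exact hγ
  have h2 : Tendsto (fun i => lin (L (V.toClosure.map (γ i)))) atTop (𝓝 (lin (L γ''))) := by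
    have h3 := (continuous_lin.tendsto _).comp (((hψ' _ _).tendsto _).comp h1)
    refine tendsto_lin_of_pointwise fun v => ?_
    refine ((continuous_linearMap (lin (eqToHom (hobj E')))).tendsto _).comp ?_
    exact tendsto_lin_apply h3 tendsto_const_nhds
  refine ⟨lin (L γ'') w', ?_, ?_⟩
  · simp only [hL] at h2
    exact tendsto_lin_apply h2 hw
  · have h3 : γ'' ≫ V.toClosure.map δ = V.toClosure.map α := lin_injective hα
    have h4 := congrArg L h3
    rw [hLcomp, hL, hL] at h4
    exact congrArg (fun f : W.toClosure.obj (ψ.obj E) ⟶ W.toClosure.obj (ψ.obj G) => lin f w') h4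

end Regular

/-! ### Lifting convergent sequences to the attached bundle -/

section Lifting

variable {V : StructureCategory.{u}} {MB XB FB : Type u} [TopologicalSpace MB]
  [TopologicalSpace XB] [TopologicalSpace FB] {A : Set MB} {a₀ : C(A, XB)} {c₀ : C(MB, FB)}
  {i₀ : C(XB, FB)} {M : Family V MB} {X : Family V XB} {F : Family V FB}

/-- Every sequence in `T` has a convergent or a locally finite subsequence. -/
def SubseqDichotomy (T : Type*) [TopologicalSpace T] : Prop :=
  ∀ x : ℕ → T, ∃ σ : ℕ → ℕ, StrictMono σ ∧
    ((∃ y, Tendsto (x ∘ σ) atTop (𝓝 y)) ∨ LocallyFinite fun i => ({x (σ i)} : Set T))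

/-- The inverse of a local trivialization, as a map to the whole family. -/
def Family.LocalTriv.tt {m : MB} (τ : M.LocalTriv m) :
    FamilyMap (Family.product τ.U τ.E) M ⟨Subtype.val, continuous_subtype_val⟩ where
  total := (M.restrictVal τ.U).total.comp τ.t.total
  hom c := τ.t.hom c
  total_chartInv c v := congrArg (M.restrictVal τ.U).total (τ.t.total_chartInv c v)

theorem Family.LocalTriv.locallyFinite [T2Space MB] {m : MB} (τ : M.LocalTriv m) {z : ℕ → τ.U}
    (hz : Tendsto (fun k => (z k).1) atTop (𝓝 m)) {e : ℕ → τ.E.space}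
    (he : LocallyFinite fun k => ({e k} : Set τ.E.space)) :
    LocallyFinite fun k => ({τ.tt.total (z k, e k)} : Set M.total) := by
  have hp : ∀ k, M.p (τ.tt.total (z k, e k)) = (z k).1 := fun k => τ.tt.p_total (z k, e k)
  rw [locallyFinite_singleton_iff]
  intro y
  by_cases hy : M.p y = m
  · have hyU : M.p y ∈ τ.U := hy ▸ τ.mem
    obtain ⟨O, hO, hfin⟩ := locallyFinite_singleton_iff.1 he (τ.s.total ⟨y, hyU⟩).2
    have hop : IsOpenEmbedding (Subtype.val : {x : M.total // M.p x ∈ τ.U} → M.total) :=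
      (τ.isOpen.preimage M.p.continuous).isOpenEmbedding_subtypeVal
    have hcont : Continuous fun x : {x : M.total // M.p x ∈ τ.U} => (τ.s.total x).2 :=
      continuous_snd.comp τ.s.total.continuous
    refine ⟨Subtype.val '' ((fun x : {x : M.total // M.p x ∈ τ.U} => (τ.s.total x).2) ⁻¹' O),
      hop.isOpenMap.image_mem_nhds (hcont.continuousAt hO), hfin.mono fun k hk => ?_⟩
    rintro ⟨x, hx, hxk⟩
    have h1 : x = τ.t.total (z k, e k) := Subtype.ext hxk
    have h2 : τ.s.total x = (z k, e k) := h1 ▸ τ.s_t (z k, e k)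
    exact hk (by simpa only [mem_preimage, h2] using hx)
  · obtain ⟨O, O', hO, hO', hyO, hmO', hd⟩ := t2_separation hy
    refine ⟨M.p ⁻¹' O, (hO.preimage M.p.continuous).mem_nhds hyO, ?_⟩
    filter_upwards [hz.eventually (hO'.mem_nhds hmO')] with k hk hk'
    rw [mem_preimage, hp] at hk'
    exact disjoint_left.1 hd hk' hk

/-- Let `β k : E ⟶ M_{m k}` be morphisms over points outside `A` such that the maps `c ∘ β k`
converge pointwise to a morphism `α'` in the attaching space `F`. After passing to a subsequence,
the `m k` converge, to a point `m'`, and, in a local trivialization, the `β k` converge to a linear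
map `γ'`, with `α' = c ∘ γ'`. -/
theorem exists_lift_of_tendsto [T2Space MB] [T1Space FB] (hMB : SubseqDichotomy MB)
    (hM : M.IsBundle) {a : FamilyMap (M.restrict A) X a₀} {c : FamilyMap M F c₀}
    {i : FamilyMap X F i₀} (h : IsAttachment (M.p ⁻¹' A) a.totalOn c.total i.total)
    {E : V.Obj} {m : ℕ → MB} (hm : ∀ k, m k ∉ A) (β : ∀ k, E ⟶ M.fiber (m k)) {b' : FB}
    (α' : E ⟶ F.fiber b')
    (hlim : ∀ v, Tendsto (fun k => c.total (M.chartInv (m k) (lin (β k) v))) atTop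
      (𝓝 (F.chartInv b' (lin α' v)))) :
    ∃ (σ : ℕ → ℕ) (m' : MB) (τ : M.LocalTriv m') (hU : ∀ k, m (σ k) ∈ τ.U)
      (γ' : E.space →ₗ[ℝ] τ.E.space), StrictMono σ ∧
      Tendsto (fun k => m (σ k)) atTop (𝓝 m') ∧
      Tendsto (fun k => lin (β (σ k) ≫ τ.s.hom ⟨m (σ k), hU k⟩)) atTop (𝓝 γ') ∧
      ∀ v, F.chartInv b' (lin α' v) = c.total (τ.tt.total (⟨m', τ.mem⟩, γ' v)) := by
  have := hM.t2Space
  have := F.t1Space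
  have hout : ∀ k v, M.chartInv (m k) v ∉ M.p ⁻¹' A := fun k v hv => by
    rw [mem_preimage, M.p_chartInv] at hv
    exact hm k hv
  obtain ⟨σ₁, hσ₁, ⟨m', hm'⟩ | hlf⟩ := hMB m
  swap
  -- if `m` is locally finite, then so are the zero vectors over it
  · have hlf' : LocallyFinite fun k =>
        ({M.chartInv (m (σ₁ k)) (lin (β (σ₁ k)) 0)} : Set M.total) :=
      locallyFinite_of_continuous M.p.continuous (by simpa only [M.p_chartInv] using hlf)
    exact absurd ((hlim 0).comp hσ₁.tendsto_atTop) (h.not_tendsto (fun k => hout _ _) hlf' _)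
  obtain ⟨τ⟩ := hM.exists_localTriv m'
  obtain ⟨N, hN⟩ := eventually_atTop.1 (hm'.eventually (τ.isOpen.mem_nhds τ.mem))
  let σ₂ : ℕ → ℕ := fun k => σ₁ (k + N)
  have hσ₂ : StrictMono σ₂ := hσ₁.comp fun _ _ hkl => Nat.add_lt_add_right hkl N
  have hU : ∀ k, m (σ₂ k) ∈ τ.U := fun k => hN _ (Nat.le_add_left _ _)
  have hm₂ : Tendsto (fun k => m (σ₂ k)) atTop (𝓝 m') := hm'.comp (tendsto_add_atTop_nat N)
  let γ : ℕ → (E.space →ₗ[ℝ] τ.E.space) := fun k =>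
    lin (β (σ₂ k) ≫ τ.s.hom ⟨m (σ₂ k), hU k⟩)
  have hγ : ∀ k v, τ.tt.total (⟨m (σ₂ k), hU k⟩, γ k v) =
      M.chartInv (m (σ₂ k)) (lin (β (σ₂ k)) v) := fun k v => by
    have h1 := congrArg (fun f => lin f (lin (β (σ₂ k)) v))
      (τ.s_hom_comp_t_hom ⟨m (σ₂ k), hU k⟩)
    exact (τ.tt.total_chartInv ⟨m (σ₂ k), hU k⟩ (γ k v)).trans
      (congrArg (M.chartInv (m (σ₂ k))) h1)
  -- an unbounded sequence of vectors over the convergent sequence `m` would be locally finite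
  have hbdd : ∀ v, ∃ K, IsCompact K ∧ ∀ k, γ k v ∈ K := by
    intro v
    rcases exists_isCompact_or_locallyFinite fun k => γ k v with hK | ⟨ρ, hρ, hlf⟩
    · exact hK
    · have hlf' := τ.locallyFinite (z := fun k => ⟨m (σ₂ (ρ k)), hU (ρ k)⟩)
        (hm₂.comp hρ.tendsto_atTop) hlf
      simp only [hγ] at hlf'
      exact absurd ((hlim v).comp (hσ₂.comp hρ).tendsto_atTop)
        (h.not_tendsto (fun k => hout _ _) hlf' _)
  obtain ⟨ρ, γ', hρ, hγ'⟩ := exists_subseq_lin hbdd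
  refine ⟨σ₂ ∘ ρ, m', τ, fun k => hU (ρ k), γ', hσ₂.comp hρ, hm₂.comp hρ.tendsto_atTop, hγ',
    fun v => ?_⟩
  have hz : Tendsto (fun k => (⟨m (σ₂ (ρ k)), hU (ρ k)⟩ : τ.U)) atTop (𝓝 ⟨m', τ.mem⟩) :=
    tendsto_subtype_rng.2 (hm₂.comp hρ.tendsto_atTop)
  have hy : Tendsto (fun k => τ.tt.total (⟨m (σ₂ (ρ k)), hU (ρ k)⟩, γ (ρ k) v)) atTop
      (𝓝 (τ.tt.total (⟨m', τ.mem⟩, γ' v))) :=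
    (τ.tt.total.continuous.tendsto _).comp
      (hz.prodMk_nhds (tendsto_lin_apply hγ' tendsto_const_nhds))
  simp only [hγ] at hy
  exact h.tendsto_unique (fun k => hout _ _) hy ((hlim v).comp (hσ₂.comp hρ).tendsto_atTop)

end Lifting

/-! ### Images of push-outs -/

section ImagePushout

variable {V W : StructureCategory.{u}} {ψ : V.Obj ⥤ W.Obj} {MB XB FB : Type u}
  [TopologicalSpace MB] [TopologicalSpace XB] [TopologicalSpace FB] {A : Set MB} {a₀ : C(A, XB)}
  {c₀ : C(MB, FB)} {i₀ : C(XB, FB)} {M : Family V MB} {X : Family V XB} {F : Family V FB}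

theorem ImageTotal.map_eq_push_of_chartInv_eq {c : FamilyMap M F c₀} {E : V.Obj} {m : MB}
    {β : E ⟶ M.fiber m} {b : FB} {α : E ⟶ F.fiber b}
    (h : ∀ v, c.total (M.chartInv m (lin β v)) = F.chartInv b (lin α v))
    (w : (ψ.obj E).space) : map c (push M β w) = push F α w := by
  rw [map_push]
  exact push_congr F (fun v => (c.total_chartInv m (lin β v)).symm.trans (h v)) w

theorem FamilyMap.exists_factor (c : FamilyMap M F c₀) {m : MB} (hm : IsIso (c.hom m)) {E : V.Obj}
    (α : E ⟶ F.fiber (c₀ m)) :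
    ∃ β : E ⟶ M.fiber m, ∀ v, c.total (M.chartInv m (lin β v)) = F.chartInv (c₀ m) (lin α v) := by
  refine ⟨α ≫ inv (c.hom m), fun v => ?_⟩
  rw [c.total_chartInv]
  exact congrArg (fun f => F.chartInv (c₀ m) (lin f (lin α v))) (IsIso.inv_hom_id (c.hom m))

/-- The topology of `ψ F` is the quotient topology of `ψ M` and `ψ X` if `F` is obtained by
attaching the vector bundle `M` to `X`. This is the point where regularity is needed. -/
theorem ImageTotal.isClosed_of_preimage [T2Space MB] [T1Space FB] (hψ : IsRegularFunctor ψ)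
    (hMB : SubseqDichotomy MB) (hA : IsClosed A) (hM : M.IsBundle)
    {a : FamilyMap (M.restrict A) X a₀} {c : FamilyMap M F c₀} {i : FamilyMap X F i₀}
    (h₀ : IsAttachment A a₀ c₀ i₀)
    (h : IsAttachment (M.p ⁻¹' A) a.totalOn c.total i.total) (hi : ∀ b, IsIso (i.hom b))
    (hc : ∀ m ∉ A, IsIso (c.hom m)) {C : Set (ImageTotal ψ F)} (h1 : IsClosed (map c ⁻¹' C))
    (h2 : IsClosed (map i ⁻¹' C)) : IsClosed C := by
  have hi₀ := h₀.isClosedEmbedding hA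
  have hie := h.isClosedEmbedding (hA.preimage M.p.continuous)
  rw [isClosed_iff]
  intro E b α b' α' hα w w' hw hmem
  by_cases hfr : ∃ᶠ k in atTop, b k ∈ range i₀
  · -- infinitely many of the morphisms come from `X`
    obtain ⟨σ, hσ, hσ'⟩ := extraction_of_frequently_atTop hfr
    have hlift : ∀ b ∈ range i₀, ∀ α : E ⟶ F.fiber b, ∃ (x : XB) (β : E ⟶ X.fiber x),
        ∀ v, i.total (X.chartInv x (lin β v)) = F.chartInv b (lin α v) := by
      rintro _ ⟨x, rfl⟩ α
      exact ⟨x, i.exists_factor (hi x) α⟩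
    obtain ⟨x', β', hβ'⟩ := hlift b' (hi₀.isClosed_range.mem_of_tendsto
      (hα.tendsto_base.comp hσ.tendsto_atTop) (Eventually.of_forall hσ')) α'
    choose x β hβ using fun k => hlift (b (σ k)) (hσ' k) (α (σ k))
    have hconv : X.Conv β β' := fun v => by
      rw [hie.tendsto_nhds_iff]
      simp only [Function.comp_def, hβ, hβ']
      exact hα.subseq hσ.tendsto_atTop v
    have := isClosed_iff.1 h2 E x β x' β' hconv _ w' (hw.comp hσ.tendsto_atTop) fun k => by
      rw [mem_preimage, map_eq_push_of_chartInv_eq (hβ k)]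
      exact hmem (σ k)
    rwa [mem_preimage, map_eq_push_of_chartInv_eq hβ'] at this
  · -- almost all of the morphisms come from the open stratum
    obtain ⟨N, hN⟩ := eventually_atTop.1 (not_frequently.1 hfr)
    have hσ : Tendsto (· + N) atTop atTop := tendsto_add_atTop_nat N
    have hlift : ∀ b ∉ range i₀, ∀ α : E ⟶ F.fiber b, ∃ m ∉ A, ∃ β : E ⟶ M.fiber m,
        ∀ v, c.total (M.chartInv m (lin β v)) = F.chartInv b (lin α v) := by
      intro b hb α
      rcases h₀.cover b with hx | ⟨m, hm, rfl⟩
      · exact absurd hx hb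
      · exact ⟨m, hm, c.exists_factor (hc m hm) α⟩
    choose m hm β hβ using fun k => hlift (b (k + N)) (hN _ (Nat.le_add_left _ _)) (α (k + N))
    obtain ⟨σ, m', τ, hU, γ', hσ', hlim, hγ', hval⟩ := exists_lift_of_tendsto hMB hM h hm β α'
      fun v => by
        simp only [hβ]
        exact (hα.subseq hσ).tendsto v
    have hb' : c₀ m' = b' := by
      have h3 := congrArg F.p (hval 0)
      rw [F.p_chartInv, c.p_total] at h3
      rw [h3]
      exact congrArg c₀ (τ.tt.p_total (⟨m', τ.mem⟩, γ' 0)).symm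
    subst hb'
    have hcomp : (lin (τ.tt.hom ⟨m', τ.mem⟩ ≫ c.hom m')).comp γ' = lin α' := by
      refine LinearMap.ext fun v => (F.isEmbedding (c₀ m')).injective ?_
      rw [hval v]
      refine (c.total_chartInv m' (lin (τ.tt.hom ⟨m', τ.mem⟩) (γ' v))).symm.trans ?_
      exact congrArg c.total (τ.tt.total_chartInv ⟨m', τ.mem⟩ (γ' v)).symm
    obtain ⟨u, hu, huw⟩ := hψ.exists_limit hγ' _ α' hcomp
      (hw.comp (hσ.comp hσ'.tendsto_atTop))
    have hz : Tendsto (fun k => (⟨m (σ k), hU k⟩ : τ.U)) atTop (𝓝 ⟨m', τ.mem⟩) :=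
      tendsto_subtype_rng.2 hlim
    have hpush := isClosed_iff.1 h1 τ.E _ _ _ _ (τ.tt.conv_of_product hz) _ u hu fun k => by
      have h3 : push (ψ := ψ) M (τ.tt.hom ⟨m (σ k), hU k⟩)
          (lin (ψ.map (β (σ k) ≫ τ.s.hom ⟨m (σ k), hU k⟩)) (w (σ k + N))) =
          push M (β (σ k)) (w (σ k + N)) := by
        refine (push_comp M _ _ _).symm.trans
          (congrArg (fun f : E ⟶ M.fiber (m (σ k)) => push M f (w (σ k + N))) ?_)
        exact (Category.assoc _ _ _).trans ((congrArg (β (σ k) ≫ ·)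
          (τ.s_hom_comp_t_hom ⟨m (σ k), hU k⟩)).trans (Category.comp_id _))
      have h4 : map c (push (ψ := ψ) M (β (σ k)) (w (σ k + N))) ∈ C := by
        rw [map_eq_push_of_chartInv_eq (hβ (σ k))]
        exact hmem (σ k + N)
      rw [← h3] at h4
      exact h4
    have h5 : map c (push (ψ := ψ) M (τ.tt.hom ⟨m', τ.mem⟩) u) = push F α' w' := by
      refine (map_push c _ u).trans ?_
      exact congrArg (fun y => (⟨c₀ m', y⟩ : ImageTotal ψ F)) huw
    exact h5 ▸ hpush

variable [T1Space MB] [T1Space XB] [T1Space FB]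

/-- The `W`-map `(ψ M)|A → ψ X` induced by a `V`-map `M|A → X`, for a closed set `A`. -/
def FamilyMap.imageOn (hψ : IsContinuousFunctor ψ) (hA : IsClosed A)
    (a : FamilyMap (M.restrict A) X a₀) :
    FamilyMap ((M.image hψ).restrict A) (X.image hψ) a₀ where
  total := ⟨_, (ImageTotal.map a).continuous.comp
    (ImageTotal.continuous_ofRestrict_of_isClosed M hA)⟩
  hom b := ψ.map (a.hom b)
  total_chartInv _ _ := rfl

theorem isAttachment_image [T2Space MB] (hψ : IsContinuousFunctor ψ) (hψ' : IsRegularFunctor ψ)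
    (hMB : SubseqDichotomy MB) (hA : IsClosed A) (hM : M.IsBundle)
    {a : FamilyMap (M.restrict A) X a₀} {c : FamilyMap M F c₀} {i : FamilyMap X F i₀}
    (h₀ : IsAttachment A a₀ c₀ i₀)
    (h : IsAttachment (M.p ⁻¹' A) a.totalOn c.total i.total) (hi : ∀ b, IsIso (i.hom b))
    (hc : ∀ m ∉ A, IsIso (c.hom m)) :
    IsAttachment ((M.image hψ).p ⁻¹' A) (a.imageOn hψ hA).totalOn (c.image hψ).total
      (i.image hψ).total := by
  have hinj : ∀ {E E' : V.Obj} (f : E ⟶ E'), IsIso f → ∀ w w', lin (ψ.map f) w = lin (ψ.map f) w' →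
      w = w' := by
    intro E E' f _ w w' hww
    have h1 := fun w => congrArg (fun g => lin g w) (IsIso.hom_inv_id (ψ.map f))
    exact (h1 w).symm.trans ((congrArg (lin (inv (ψ.map f))) hww).trans (h1 w'))
  have hsurj : ∀ {E E' : V.Obj} (f : E ⟶ E'), IsIso f → ∀ w, ∃ w', lin (ψ.map f) w' = w :=
    fun f _ w => ⟨lin (inv (ψ.map f)) w,
      congrArg (fun g => lin g w) (IsIso.inv_hom_id (ψ.map f))⟩
  have hmap : ∀ {Y : Type u} [TopologicalSpace Y] {G : Family V Y} {g₀ : C(Y, FB)}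
      (g : FamilyMap G F g₀) (x y : ImageTotal ψ G), IsIso (g.hom x.pt) → x.pt = y.pt →
      ImageTotal.map g x = ImageTotal.map g y → x = y := by
    rintro Y _ G g₀ g ⟨b, w⟩ ⟨b', w'⟩ hiso hb hxy
    obtain rfl : b = b' := hb
    have h1 : lin (ψ.map (g.hom b)) w = lin (ψ.map (g.hom b)) w' := by
      have := (ImageTotal.mk.injEq _ _ _ _).mp hxy
      exact eq_of_heq this.2
    rw [hinj _ hiso w w' h1]
  refine ⟨?_, ?_, ?_, ?_, ?_, ?_⟩
  · rintro ⟨⟨m, w⟩, hm⟩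
    refine (ImageTotal.push_congr F (fun v => ?_) w).trans
      (ImageTotal.push_comp F (a.hom ⟨m, hm⟩) (i.hom _) w)
    have h1 := h.comm ⟨M.chartInv m v, M.chartInv_mem A ⟨m, hm⟩ v⟩
    refine (c.total_chartInv m v).symm.trans (h1.trans ?_)
    refine (congrArg i.total (a.total_chartInv ⟨m, hm⟩ v)).trans ?_
    exact i.total_chartInv _ _
  · intro x y hxy
    exact hmap i x y (hi _) (h₀.inj_i (congrArg ImageTotal.pt hxy)) hxy
  · intro x hx y hy hxy
    exact hmap c x y (hc _ hx) (h₀.inj _ hx _ hy (congrArg ImageTotal.pt hxy)) hxy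
  · intro x hx y hxy
    exact h₀.ne _ hx y.pt (congrArg ImageTotal.pt hxy)
  · rintro ⟨b, w⟩
    rcases h₀.cover b with ⟨x, rfl⟩ | ⟨m, hm, rfl⟩
    · obtain ⟨w', rfl⟩ := hsurj _ (hi x) w
      exact Or.inl ⟨⟨x, w'⟩, rfl⟩
    · obtain ⟨w', rfl⟩ := hsurj _ (hc m hm) w
      exact Or.inr ⟨⟨m, w'⟩, hm, rfl⟩
  · intro C h1 h2
    exact ImageTotal.isClosed_of_preimage hψ' hMB hA hM h₀ h hi hc h1 h2

end ImagePushout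

/-! ### The image of a stratified bundle -/

theorem StratifiedSpace.subseqDichotomy_M (B : StratifiedSpace.{u}) (n : ℕ) :
    SubseqDichotomy (B.M n) := by
  obtain ⟨_, _, -⟩ := B.isCWPair n
  exact exists_subseq_of_cwComplex

namespace StratifiedBundle

variable {V W : StructureCategory.{u}} {ψ : V.Obj ⥤ W.Obj} {B B' B'' : StratifiedSpace.{u}}

/-- The map `(ψ M_n)|A_n → (ψ X)|B_n` that attaches `ψ M_n`. -/
def imageAttach (hψ : IsContinuousFunctor ψ) (X : StratifiedBundle V B) (n : ℕ) :
    FamilyMap (((X.M n).image hψ).restrict (B.A n)) ((X.fam.image hψ).restrict (B.filt n))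
      (B.attach n) where
  total := ⟨_, (ImageTotal.continuous_toRestrict X.fam).comp
    ((X.attach n).imageOn hψ (B.isClosed_A n)).total.continuous⟩
  hom a := ψ.map ((X.attach n).hom a)
  total_chartInv _ _ := rfl

/-- The characteristic map `ψ M_n → (ψ X)|B_{n+1}`. -/
def imageChar (hψ : IsContinuousFunctor ψ) (X : StratifiedBundle V B) (n : ℕ) :
    FamilyMap ((X.M n).image hψ) ((X.fam.image hψ).restrict (B.filt (n + 1))) (B.char n) where
  total := ⟨_, (ImageTotal.continuous_toRestrict X.fam).comp
    ((X.char n).image hψ).total.continuous⟩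
  hom a := ψ.map ((X.char n).hom a)
  total_chartInv _ _ := rfl

theorem isPushout_image (hψ : IsContinuousFunctor ψ) (hψ' : IsRegularFunctor ψ)
    (X : StratifiedBundle V B) (n : ℕ) :
    IsPushout (((X.M n).image hψ).restrictVal (B.A n)).toHom (X.imageAttach hψ n).toHom
      (X.imageChar hψ n).toHom ((X.fam.image hψ).restrictInclusion (B.filt_le n)).toHom := by
  obtain ⟨h, hc⟩ := isAttachment_of_isPushout_family (B.isClosed_A n) (B.isAttachment n)
    (X.isPushout n)
  have hi : ∀ b, IsIso ((X.fam.restrictInclusion (B.filt_le n)).hom b) := fun b =>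
    inferInstanceAs (IsIso (𝟙 (X.fam.fiber b.1)))
  have himage := isAttachment_image hψ hψ' (B.subseqDichotomy_M n) (B.isClosed_A n)
    (X.isBundle n) (B.isAttachment n) h hi hc
  have hofTo : ∀ m, ∃ (d : C(((X.fam.image hψ).restrict (B.filt m)).total,
        ((X.fam.restrict (B.filt m)).image hψ).total))
      (d' : C(((X.fam.restrict (B.filt m)).image hψ).total,
        ((X.fam.image hψ).restrict (B.filt m)).total)),
      (∀ x, d x = ImageTotal.ofRestrict X.fam (B.filt m) x) ∧
      (∀ x, d' (d x) = x) ∧ (∀ x, d (d' x) = x) := fun m =>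
    ⟨⟨_, ImageTotal.continuous_ofRestrict_of_isClosed X.fam (B.isClosed_filt m)⟩,
      ⟨_, ImageTotal.continuous_toRestrict X.fam⟩, fun _ => rfl, fun _ => rfl, fun _ => rfl⟩
  obtain ⟨d, d', hd, hdd', hd'd⟩ := hofTo n
  obtain ⟨e, e', he, hee', -⟩ := hofTo (n + 1)
  refine isPushout_of_isAttachment (B.isAttachment n)
    (himage.of_inverse d d' hdd' hd'd e e' hee' ?_ ?_ ?_) ?_ ?_
  · exact fun x => hd _
  · exact fun m => he _
  · intro x
    rw [hd]
    refine (he _).trans ?_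
    exact (ImageTotal.push_id (ψ := ψ) (X.fam.restrict (B.filt (n + 1)))
      ⟨x.1.pt, B.filt_le n x.2⟩ x.1.vec).symm
  · exact fun b => inferInstanceAs (IsIso (𝟙 (ψ.obj (X.fam.fiber b.1))))
  · intro m hm
    have := hc m hm
    exact inferInstanceAs (IsIso (ψ.map ((X.char n).hom m)))

theorem coherent_image (hψ : IsContinuousFunctor ψ) (X : StratifiedBundle V B) :
    IsCoherentWith (range fun n => (X.fam.image hψ).p ⁻¹' B.filt n) := by
  refine .of_isClosed fun C hC => ?_
  refine ImageTotal.isClosed_iff.2 fun E b α b' α' hα w w' hw hmem => ?_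
  obtain ⟨n, hn⟩ := B.exists_frequently_mem_filt hα.tendsto_base
  obtain ⟨σ, hσ, hσ'⟩ := extraction_of_frequently_atTop hn
  have hcl : IsClosed ((X.fam.image hψ).p ⁻¹' B.filt n) :=
    (B.isClosed_filt n).preimage (X.fam.image hψ).p.continuous
  have h1 : IsClosed ((X.fam.image hψ).p ⁻¹' B.filt n ∩ C) := by
    rw [← Subtype.image_preimage_coe]
    exact (hC _ ⟨n, rfl⟩).trans hcl
  exact (ImageTotal.isClosed_iff.1 h1 E _ _ b' α' (hα.subseq hσ.tendsto_atTop) _ w'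
    (hw.comp hσ.tendsto_atTop) fun i => ⟨hσ' i, hmem (σ i)⟩).2

/-- The stratified bundle `ψ X`. -/
def image (hψ : IsContinuousFunctor ψ) (hψ' : IsRegularFunctor ψ) (X : StratifiedBundle V B) :
    StratifiedBundle W B where
  fam := X.fam.image hψ
  isBundle_zero := X.isBundle_zero.image_restrict hψ (B.isClosed_filt 0)
  M n := (X.M n).image hψ
  isBundle n := (X.isBundle n).image hψ
  attach n := X.imageAttach hψ n
  char n := X.imageChar hψ n
  isPushout n := X.isPushout_image hψ hψ' n
  coherent := X.coherent_image hψ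

theorem MapOver.ext {X : StratifiedBundle V B} {Y : StratifiedBundle V B'} {φ : B ⟶ B'}
    {r s : X.MapOver Y φ} (hf : ∀ x, r.f.total x = s.f.total x)
    (hg : ∀ n x, (r.g n).total x = (s.g n).total x) : r = s := by
  have h1 : r.f = s.f := FamilyMap.ext_total (ContinuousMap.ext hf)
  have h2 : r.g = s.g := funext fun n => FamilyMap.ext_total (ContinuousMap.ext (hg n))
  cases r; cases s; cases h1; cases h2; rfl

/-- The stratified map `ψ X → ψ Y` induced by a stratified map `X → Y`. -/
def MapOver.image (hψ : IsContinuousFunctor ψ) (hψ' : IsRegularFunctor ψ)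
    {X : StratifiedBundle V B} {Y : StratifiedBundle V B'} {φ : B ⟶ B'} (r : X.MapOver Y φ) :
    (X.image hψ hψ').MapOver (Y.image hψ hψ') φ where
  f := r.f.image hψ
  g n := (r.g n).image hψ
  attach_comm n x y h := by
    obtain ⟨⟨m, w⟩, hm⟩ := x
    obtain ⟨⟨m', w'⟩, hm'⟩ := y
    have h : (⟨m', w'⟩ : ImageTotal ψ (Y.M n)) = ⟨φ.g n m, lin (ψ.map ((r.g n).hom m)) w⟩ := h
    cases h
    let a : B.A n := ⟨m, hm⟩
    let a' : B'.A n := ⟨φ.g n m, hm'⟩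
    refine (ImageTotal.push_comp Y.fam ((X.attach n).hom a) (r.f.hom (B.attach n a).1) w).symm.trans
      (Eq.trans ?_ (ImageTotal.push_comp Y.fam ((r.g n).hom m) ((Y.attach n).hom a') w))
    refine ImageTotal.push_congr Y.fam (fun v => ?_) w
    have h1 := r.attach_comm n (((X.M n).restrict (B.A n)).chartInv a v)
      (((Y.M n).restrict (B'.A n)).chartInv a' (lin ((r.g n).hom m) v))
      ((r.g n).total_chartInv m v).symm
    have h2 := congrArg Subtype.val ((X.attach n).total_chartInv a v)
    have h3 := congrArg Subtype.val ((Y.attach n).total_chartInv a' (lin ((r.g n).hom m) v))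
    exact (r.f.total_chartInv _ _).symm.trans ((congrArg r.f.total h2).symm.trans (h1.trans h3))
  char_comm n x := by
    obtain ⟨m, w⟩ := x
    refine (ImageTotal.push_comp Y.fam ((X.char n).hom m) (r.f.hom (B.char n m).1) w).symm.trans
      (Eq.trans ?_ (ImageTotal.push_comp Y.fam ((r.g n).hom m) ((Y.char n).hom (φ.g n m)) w))
    refine ImageTotal.push_congr Y.fam (fun v => ?_) w
    have h1 := r.char_comm n ((X.M n).chartInv m v)
    have h2 := congrArg Subtype.val ((X.char n).total_chartInv m v)
    have h3 := congrArg Subtype.val ((congrArg (Y.char n).total ((r.g n).total_chartInv m v)).trans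
      ((Y.char n).total_chartInv (φ.g n m) (lin ((r.g n).hom m) v)))
    exact (r.f.total_chartInv _ _).symm.trans ((congrArg r.f.total h2).symm.trans (h1.trans h3))

end StratifiedBundle

variable {V W : StructureCategory.{u}} {ψ : V.Obj ⥤ W.Obj}

/-- The functor from `V`-stratified bundles to `W`-stratified bundles induced by `ψ`. -/
def imageFunctor (hψ : IsContinuousFunctor ψ) (hψ' : IsRegularFunctor ψ) :
    FunctorOverBase V W where
  obj X := X.image hψ hψ'
  map r := r.image hψ hψ'
  map_id X := StratifiedBundle.MapOver.ext
    (fun x => ImageTotal.push_id X.fam x.pt x.vec)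
    (fun n x => ImageTotal.push_id (X.M n) x.pt x.vec)
  map_comp {_ _ _ _ _ Z _ _} r s := StratifiedBundle.MapOver.ext
    (fun x => ImageTotal.push_comp Z.fam (r.f.hom x.pt) (s.f.hom _) x.vec)
    (fun n x => ImageTotal.push_comp (Z.M n) ((r.g n).hom x.pt) ((s.g n).hom _) x.vec)

theorem bundleImage_image (hψ : IsContinuousFunctor ψ) (hψ' : IsRegularFunctor ψ)
    {B : StratifiedSpace.{u}} (X : StratifiedBundle V B) : BundleImage ψ X (X.image hψ hψ') where
  fibers _ := rfl
  fibersM _ _ := rfl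
  bundle_zero := productMapsImage_restrict hψ X.isBundle_zero
  bundleM n := productMapsImage_image hψ (X.isBundle n)
  attach _ := mapImage_of_hom_eq fun _ => HEq.rfl
  char _ := mapImage_of_hom_eq fun _ => HEq.rfl

end StratVect

end

theorem mainTheorem4 (V W : StratVect.StructureCategory.{u}) (ψ : V.Obj ⥤ W.Obj)
    (hcont : StratVect.IsContinuousFunctor ψ) (hreg : StratVect.IsRegularFunctor ψ) :
    ∃ Ψ : StratVect.VStra V ⥤ StratVect.VStra W, StratVect.IsInducedFunctor ψ Ψ :=
  ⟨(StratVect.imageFunctor hcont hreg).toFunctor, StratVect.imageFunctor hcont hreg, rfl,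
    StratVect.bundleImage_image hcont hreg, fun _ =>
      ⟨StratVect.mapImage_of_hom_eq fun _ => HEq.rfl,
        fun _ => StratVect.mapImage_of_hom_eq fun _ => HEq.rfl⟩⟩
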